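/- **Theorem 3.4.** Let $(\tilde M,g,J)$ be a nearly Kaehler manifold, that is, a Riemannian manifold with Levi-Civita connection $\tilde\nabla$ and a smooth almost complex structure $J$ such that $g(JX,JY)=g(X,Y)$ and $(\tilde\nabla_XJ)Y+(\tilde\nabla_YJ)X=0$ for all vector fields $X,Y$. Let $M_T$, $M_\perp$, $M_\theta$ be non-empty Riemannian manifolds, with $M_T$ connected and $\dim M_\theta>0$, and let $f_1,f_2$ be positive smooth functions on $M_T$. Let $M=M_T\times_{f_1}M_\perp\times_{f_2}M_\theta$ be the bi-warped product, i.e. the manifold $M_T\times M_\perp\times M_\theta$ with the metric $$g(X,Y)=g_T(\pi_{0*}X,\pi_{0*}Y)+(f_1\circ\pi_0)^2\,g_\perp(\pi_{1*}X,\pi_{1*}Y)+(f_2\circ\pi_0)^2\,g_\theta(\pi_{2*}X,\pi_{2*}Y),$$ where $\pi_0,\pi_1,\pi_2$ are the projections to the three factors. Suppose that $M$ is isometrically immersed in $\tilde M$, and put $\mathfrak D=TM_T$, $\mathfrak D^\perp=TM_\perp$, $\mathfrak D^\theta=TM_\theta$ (distributions on $M$). Suppose that $M_T$, $M_\perp$,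 $M_\theta$ are, respectively, holomorphic ($J\mathfrak D=\mathfrak D$), totally real ($J\mathfrak D^\perp$ is orthogonal to $\mathfrak D^\perp$) and proper slant in $\tilde M$ (for a constant $\theta\in(0,\pi/2)$, the angle between $JX$ and $\mathfrak D^\theta_p$ is $\theta$ for all $p\in M$ and $0\ne X\in\mathfrak D^\theta_p$). Let $h$ be the second fundamental form of $M$ in $\tilde M$. If $M$ is $\mathfrak D\oplus\mathfrak D^\theta$-mixed totally geodesic, i.e. $h(X_1,X_2)=0$ for all $X_1\in\Gamma(\mathfrak D)$ and $X_2\in\Gamma(\mathfrak D^\theta)$, then $f_2$ is constant. (It is not required that $f_1$ and $f_2$ be non-constant. In particular, a proper bi-warped product, one with neither $f_1$ nor $f_2$ constant, cannot be $\mathfrak D\oplus\mathfrak D^\theta$-mixed totally geodesic.) -/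

import Mathlib

open Bundle
open scoped Manifold ContDiff

noncomputable section

namespace NearlyKaehler

/-- The Christoffel symbols of the first kind, at the point `y`, of a metric tensor `G` on a vector
space: the linear form `w ↦ ½ (∂_u G(v, w) + ∂_v G(u, w) - ∂_w G(u, v))`. -/
def christoffelFirst {E : Type*} [NormedAddCommGroup E] [NormedSpace ℝ E]
    (G : E → E →L[ℝ] E →L[ℝ] ℝ) (y u v : E) : E →L[ℝ] ℝ :=
  (1 / 2 : ℝ) • (fderiv ℝ G y u v + fderiv ℝ G y v u - ((fderiv ℝ G y).flip u).flip v)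

/-! ### Ambient Riemannian manifold: Levi-Civita connection

`N` is a manifold without boundary modelled on the finite-dimensional space `E`, and its Riemannian
metric is the inner product `inner ℝ` carried by the tangent spaces. -/

section Ambient

variable {E : Type*} [NormedAddCommGroup E] [NormedSpace ℝ E] [FiniteDimensional ℝ E]
  {N : Type*} [TopologicalSpace N] [ChartedSpace E N]

instance finiteDimensional_tangentSpace (q : N) :
    FiniteDimensional ℝ (TangentSpace 𝓘(ℝ, E) q) :=
  inferInstanceAs (FiniteDimensional ℝ E)

variable [RiemannianBundle (fun x : N ↦ TangentSpace 𝓘(ℝ, E) x)]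

instance completeSpace_tangentSpace (q : N) : CompleteSpace (TangentSpace 𝓘(ℝ, E) q) :=
  FiniteDimensional.complete ℝ _

instance hasOrthogonalProjection_tangentSpace (q : N)
    (W : Submodule ℝ (TangentSpace 𝓘(ℝ, E) q)) : W.HasOrthogonalProjection :=
  haveI : CompleteSpace W := FiniteDimensional.complete ℝ W
  inferInstance

/-- The Riemannian metric of `N` read in the preferred chart `φ` at `q`: the bilinear form
`(v, w) ↦ g_{φ⁻¹ y} (dφ⁻¹ v, dφ⁻¹ w)` on the coordinate space `E`, at the coordinate point `y`. -/
def chartMetric (q : N) (y : E) : E →L[ℝ] E →L[ℝ] ℝ :=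
  let φ := extChartAt 𝓘(ℝ, E) q
  let A : E →L[ℝ] TangentSpace 𝓘(ℝ, E) (φ.symm y) := mfderiv 𝓘(ℝ, E) 𝓘(ℝ, E) φ.symm y
  (innerSL ℝ : TangentSpace 𝓘(ℝ, E) (φ.symm y) →L[ℝ]
    TangentSpace 𝓘(ℝ, E) (φ.symm y) →L[ℝ] ℝ).bilinearComp A A

/-- The Christoffel symbols (of the second kind) at `q` in the chart at `q`. Recall that
`TangentSpace 𝓘(ℝ, E) q` is the coordinate space `E` of the chart at `q`; `Γ(u, v)` is the
vector such that `g_q (Γ(u, v), w) = ½ (∂_u g(v, w) + ∂_v g(u, w) - ∂_w g(u, v))` for all `w`. -/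
def christoffel (q : N) (u v : TangentSpace 𝓘(ℝ, E) q) : TangentSpace 𝓘(ℝ, E) q :=
  let ℓ : StrongDual ℝ (TangentSpace 𝓘(ℝ, E) q) := 
    christoffelFirst (E := E) (chartMetric q) (extChartAt 𝓘(ℝ, E) q q) u v
  (InnerProductSpace.toDual ℝ (TangentSpace 𝓘(ℝ, E) q)).symm ℓ

variable {EM : Type*} [NormedAddCommGroup EM] [NormedSpace ℝ EM]
  {HM : Type*} [TopologicalSpace HM] (IM : ModelWithCorners ℝ EM HM)
  {M : Type*} [TopologicalSpace M] [ChartedSpace HM M]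

/-- The Levi-Civita covariant derivative `∇̃_u V` at `p`, in the direction `u ∈ T_p M`, of a vector
field `V` along a map `i : M → N` (so `V x ∈ T_{i x} N`). In the chart of `N` at `i p` it is
`∂_u V + Γ(di u, V)`. -/
def covDerivAlong (i : M → N) (V : ∀ x : M, TangentSpace 𝓘(ℝ, E) (i x)) (p : M)
    (u : TangentSpace IM p) : TangentSpace 𝓘(ℝ, E) (i p) :=
  let Vφ : M → E := fun x ↦ mfderiv 𝓘(ℝ, E) 𝓘(ℝ, E) (extChartAt 𝓘(ℝ, E) (i p)) (i x) (V x)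
  let dVφ : TangentSpace 𝓘(ℝ, E) (i p) := mfderiv IM 𝓘(ℝ, E) Vφ p u
  dVφ + christoffel (i p) (mfderiv IM 𝓘(ℝ, E) i p u) (V p)

/-- The Levi-Civita covariant derivative `∇̃_u Y` at `q` of a vector field `Y` on `N`. -/
def covDeriv (Y : ∀ x : N, TangentSpace 𝓘(ℝ, E) x) (q : N) (u : TangentSpace 𝓘(ℝ, E) q) :
    TangentSpace 𝓘(ℝ, E) q :=
  covDerivAlong 𝓘(ℝ, E) (fun x : N ↦ x) Y q u

/-- `((∇̃_X J) Y)(q) = (∇̃_X (J Y))(q) - J (∇̃_X Y)(q)`. -/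
def covDerivEnd (J : ∀ x : N, TangentSpace 𝓘(ℝ, E) x →L[ℝ] TangentSpace 𝓘(ℝ, E) x)
    (X Y : ∀ x : N, TangentSpace 𝓘(ℝ, E) x) (q : N) : TangentSpace 𝓘(ℝ, E) q :=
  covDeriv (fun x ↦ J x (Y x)) q (X q) - J q (covDeriv Y q (X q))

/-- `J` makes the Riemannian manifold `N` a nearly Kaehler manifold: `J` is a smooth almost complex
structure, compatible with the metric, and `(∇̃_X J) Y + (∇̃_Y J) X = 0`. The last condition is
local, so it is stated for vector fields that are smooth around the point considered. -/
structure IsNearlyKaehler [IsManifold 𝓘(ℝ, E) ∞ N]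
    (J : ∀ x : N, TangentSpace 𝓘(ℝ, E) x →L[ℝ] TangentSpace 𝓘(ℝ, E) x) : Prop where
  smooth : ContMDiff 𝓘(ℝ, E) (𝓘(ℝ, E).prod 𝓘(ℝ, E →L[ℝ] E)) ∞
    (fun x : N ↦ (TotalSpace.mk' (E →L[ℝ] E)
      (E := fun x : N ↦ TangentSpace 𝓘(ℝ, E) x →L[ℝ] TangentSpace 𝓘(ℝ, E) x) x (J x)))
  sq : ∀ (x : N) (v : TangentSpace 𝓘(ℝ, E) x), J x (J x v) = -v
  isometric : ∀ (x : N) (v w : TangentSpace 𝓘(ℝ, E) x), inner ℝ (J x v) (J x w) = inner ℝ v w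
  nearly : ∀ (q : N) (X Y : ∀ x : N, TangentSpace 𝓘(ℝ, E) x),
    ContMDiffAt 𝓘(ℝ, E) 𝓘(ℝ, E).tangent ∞ (fun x ↦ (⟨x, X x⟩ : TangentBundle 𝓘(ℝ, E) N)) q →
    ContMDiffAt 𝓘(ℝ, E) 𝓘(ℝ, E).tangent ∞ (fun x ↦ (⟨x, Y x⟩ : TangentBundle 𝓘(ℝ, E) N)) q →
    covDerivEnd J X Y q + covDerivEnd J Y X q = 0

/-- The second fundamental form `h(X, Y)` at `p` of the immersion `i : M → N`: the component of
`∇̃_X (i_* Y)` normal to `M`. -/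
def secondFundamentalForm (i : M → N) (X Y : ∀ x : M, TangentSpace IM x) (p : M) :
    TangentSpace 𝓘(ℝ, E) (i p) :=
  (LinearMap.range (mfderiv IM 𝓘(ℝ, E) i p).toLinearMap)ᗮ.starProjection
    (covDerivAlong IM i (fun x ↦ mfderiv IM 𝓘(ℝ, E) i x (Y x)) p (X p))

/-- The angle between a vector `v` and a subspace `W`, namely the angle between `v` and its
orthogonal projection to `W` (it is `π / 2` if this projection vanishes). -/
def angleToSubspace {q : N} (v : TangentSpace 𝓘(ℝ, E) q)
    (W : Submodule ℝ (TangentSpace 𝓘(ℝ, E) q)) : ℝ :=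
  InnerProductGeometry.angle v (W.starProjection v)

end Ambient

/-! ### Bi-warped product submanifolds -/

section BiWarped

variable {E₀ E₁ E₂ : Type*}
  [NormedAddCommGroup E₀] [NormedSpace ℝ E₀]
  [NormedAddCommGroup E₁] [NormedSpace ℝ E₁]
  [NormedAddCommGroup E₂] [NormedSpace ℝ E₂]
  {M₀ M₁ M₂ : Type*}
  [TopologicalSpace M₀] [ChartedSpace E₀ M₀]
  [TopologicalSpace M₁] [ChartedSpace E₁ M₁]
  [TopologicalSpace M₂] [ChartedSpace E₂ M₂]

variable (E₀ E₁ E₂) in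
/-- The model of the triple product `M₀ × M₁ × M₂`. -/
abbrev tripleModel : ModelWithCorners ℝ (E₀ × E₁ × E₂) (ModelProd E₀ (ModelProd E₁ E₂)) :=
  𝓘(ℝ, E₀).prod (𝓘(ℝ, E₁).prod 𝓘(ℝ, E₂))

/-- The tangent map of the projection `M₀ × M₁ × M₂ → M₀`. -/
def dπ₀ (x : M₀ × M₁ × M₂) :
    TangentSpace (tripleModel E₀ E₁ E₂) x →L[ℝ] TangentSpace 𝓘(ℝ, E₀) x.1 :=
  mfderiv (tripleModel E₀ E₁ E₂) 𝓘(ℝ, E₀) (fun y : M₀ × M₁ × M₂ ↦ y.1) x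

/-- The tangent map of the projection `M₀ × M₁ × M₂ → M₁`. -/
def dπ₁ (x : M₀ × M₁ × M₂) :
    TangentSpace (tripleModel E₀ E₁ E₂) x →L[ℝ] TangentSpace 𝓘(ℝ, E₁) x.2.1 :=
  mfderiv (tripleModel E₀ E₁ E₂) 𝓘(ℝ, E₁) (fun y : M₀ × M₁ × M₂ ↦ y.2.1) x

/-- The tangent map of the projection `M₀ × M₁ × M₂ → M₂`. -/
def dπ₂ (x : M₀ × M₁ × M₂) :
    TangentSpace (tripleModel E₀ E₁ E₂) x →L[ℝ] TangentSpace 𝓘(ℝ, E₂) x.2.2 :=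
  mfderiv (tripleModel E₀ E₁ E₂) 𝓘(ℝ, E₂) (fun y : M₀ × M₁ × M₂ ↦ y.2.2) x

variable (E₀ E₁ E₂) in
/-- The distribution `TM₀` on `M₀ × M₁ × M₂`. -/
def dist₀ (x : M₀ × M₁ × M₂) : Submodule ℝ (TangentSpace (tripleModel E₀ E₁ E₂) x) :=
  LinearMap.ker (dπ₁ x).toLinearMap ⊓ LinearMap.ker (dπ₂ x).toLinearMap

variable (E₀ E₁ E₂) in
/-- The distribution `TM₁` on `M₀ × M₁ × M₂`. -/
def dist₁ (x : M₀ × M₁ × M₂) : Submodule ℝ (TangentSpace (tripleModel E₀ E₁ E₂) x) :=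
  LinearMap.ker (dπ₀ x).toLinearMap ⊓ LinearMap.ker (dπ₂ x).toLinearMap

variable (E₀ E₁ E₂) in
/-- The distribution `TM₂` on `M₀ × M₁ × M₂`. -/
def dist₂ (x : M₀ × M₁ × M₂) : Submodule ℝ (TangentSpace (tripleModel E₀ E₁ E₂) x) :=
  LinearMap.ker (dπ₀ x).toLinearMap ⊓ LinearMap.ker (dπ₁ x).toLinearMap

/-- The bi-warped product metric
`g(v, w) = g₀(π₀_* v, π₀_* w) + f₁² g₁(π₁_* v, π₁_* w) + f₂² g₂(π₂_* v, π₂_* w)`. -/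
def biWarpedMetric
    [RiemannianBundle (fun x : M₀ ↦ TangentSpace 𝓘(ℝ, E₀) x)]
    [RiemannianBundle (fun x : M₁ ↦ TangentSpace 𝓘(ℝ, E₁) x)]
    [RiemannianBundle (fun x : M₂ ↦ TangentSpace 𝓘(ℝ, E₂) x)]
    (f₁ f₂ : M₀ → ℝ) (x : M₀ × M₁ × M₂)
    (v w : TangentSpace (tripleModel E₀ E₁ E₂) x) : ℝ :=
  inner ℝ (dπ₀ x v) (dπ₀ x w) + f₁ x.1 ^ 2 * inner ℝ (dπ₁ x v) (dπ₁ x w)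
    + f₂ x.1 ^ 2 * inner ℝ (dπ₂ x v) (dπ₂ x w)

variable {E : Type*} [NormedAddCommGroup E] [NormedSpace ℝ E] [FiniteDimensional ℝ E]
  {N : Type*} [TopologicalSpace N] [ChartedSpace E N]
  [RiemannianBundle (fun x : N ↦ TangentSpace 𝓘(ℝ, E) x)]

variable (E) in
/-- The image in `T_{i x} N` of a subspace of `T_x (M₀ × M₁ × M₂)`. -/
def pushSubspace (i : M₀ × M₁ × M₂ → N) (x : M₀ × M₁ × M₂)
    (W : Submodule ℝ (TangentSpace (tripleModel E₀ E₁ E₂) x)) :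
    Submodule ℝ (TangentSpace 𝓘(ℝ, E) (i x)) :=
  W.map (mfderiv (tripleModel E₀ E₁ E₂) 𝓘(ℝ, E) i x).toLinearMap

variable (E₀ E₁ E₂ E) in
/-- `i` immerses the bi-warped product `M₀ ×_{f₁} M₁ ×_{f₂} M₂` isometrically in the almost Hermitian
manifold `(N, J)`, so that (all the copies in the product of) `M₀`, `M₁`, `M₂` are respectively
holomorphic, totally real, and proper slant with slant angle `θ` in `N`. -/
structure IsBiWarpedProductSubmanifold
    [RiemannianBundle (fun x : M₀ ↦ TangentSpace 𝓘(ℝ, E₀) x)]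
    [RiemannianBundle (fun x : M₁ ↦ TangentSpace 𝓘(ℝ, E₁) x)]
    [RiemannianBundle (fun x : M₂ ↦ TangentSpace 𝓘(ℝ, E₂) x)]
    (J : ∀ x : N, TangentSpace 𝓘(ℝ, E) x →L[ℝ] TangentSpace 𝓘(ℝ, E) x)
    (f₁ f₂ : M₀ → ℝ) (θ : ℝ) (i : M₀ × M₁ × M₂ → N) : Prop where
  smooth_f₁ : ContMDiff 𝓘(ℝ, E₀) 𝓘(ℝ, ℝ) ∞ f₁
  smooth_f₂ : ContMDiff 𝓘(ℝ, E₀) 𝓘(ℝ, ℝ) ∞ f₂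
  pos_f₁ : ∀ a, 0 < f₁ a
  pos_f₂ : ∀ a, 0 < f₂ a
  smooth : ContMDiff (tripleModel E₀ E₁ E₂) 𝓘(ℝ, E) ∞ i
  isometric : ∀ (x : M₀ × M₁ × M₂) (v w : TangentSpace (tripleModel E₀ E₁ E₂) x),
    inner ℝ (mfderiv (tripleModel E₀ E₁ E₂) 𝓘(ℝ, E) i x v)
      (mfderiv (tripleModel E₀ E₁ E₂) 𝓘(ℝ, E) i x w) = biWarpedMetric f₁ f₂ x v w
  holomorphic : ∀ x : M₀ × M₁ × M₂,
    (pushSubspace E i x (dist₀ E₀ E₁ E₂ x)).map (J (i x)).toLinearMap = pushSubspace E i x (dist₀ E₀ E₁ E₂ x)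
  totally_real : ∀ x : M₀ × M₁ × M₂,
    (pushSubspace E i x (dist₁ E₀ E₁ E₂ x)).map (J (i x)).toLinearMap ≤ (pushSubspace E i x (dist₁ E₀ E₁ E₂ x))ᗮ
  angle_pos : 0 < θ
  angle_lt : θ < Real.pi / 2
  slant : ∀ x : M₀ × M₁ × M₂, ∀ v ∈ pushSubspace E i x (dist₂ E₀ E₁ E₂ x), v ≠ 0 →
    angleToSubspace (J (i x) v) (pushSubspace E i x (dist₂ E₀ E₁ E₂ x)) = θ

variable (E₀ E₁ E₂ E) in
/-- The immersion `i` of `M₀ × M₁ × M₂` in `N` is `TM₀ ⊕ TM₂`-mixed totally geodesic: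
`h(X, Y) = 0` for `X` in `TM₀` and `Y` in `TM₂`. As `h` is a tensor, this is stated at each
point for vector fields that are smooth around it. -/
def IsMixedTotallyGeodesic [IsManifold 𝓘(ℝ, E₀) ∞ M₀] [IsManifold 𝓘(ℝ, E₁) ∞ M₁]
    [IsManifold 𝓘(ℝ, E₂) ∞ M₂] (i : M₀ × M₁ × M₂ → N) : Prop :=
  ∀ (p : M₀ × M₁ × M₂) (X Y : ∀ x : M₀ × M₁ × M₂, TangentSpace (tripleModel E₀ E₁ E₂) x),
    ContMDiffAt (tripleModel E₀ E₁ E₂) (tripleModel E₀ E₁ E₂).tangent ∞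
      (fun x ↦ (⟨x, X x⟩ : TangentBundle (tripleModel E₀ E₁ E₂) (M₀ × M₁ × M₂))) p →
    ContMDiffAt (tripleModel E₀ E₁ E₂) (tripleModel E₀ E₁ E₂).tangent ∞
      (fun x ↦ (⟨x, Y x⟩ : TangentBundle (tripleModel E₀ E₁ E₂) (M₀ × M₁ × M₂))) p →
    (∀ x, X x ∈ dist₀ E₀ E₁ E₂ x) → (∀ x, Y x ∈ dist₂ E₀ E₁ E₂ x) →
    secondFundamentalForm (E := E) (tripleModel E₀ E₁ E₂) i X Y p = 0

end BiWarped

end NearlyKaehler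

end

/-! ### Calculus on normed spaces. -/

noncomputable section

namespace NearlyKaehler

open Filter Topology

/-! Let `X` be tangent to the first factor and `Z ≠ 0` to the third, both with constant components
in product coordinates, and write `l = X(f₂) / f₂`. Koszul's formula for the warped metric gives `l
Z` as the tangential part of `∇̃_X Z`; mixed total geodesy removes the normal part, so `∇̃_X Z =
∇̃_Z X = l Z`. The theorem follows by computing `⟨∇̃_Z (JX), JZ⟩` in two ways.

Using `J`: since `⟨JX, JZ⟩ = ⟨X, Z⟩ = 0`, the product equals `-⟨JX, ∇̃_Z (JZ)⟩`. The nearly Kaehler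
identity on the diagonal, `(∇̃_Z J) Z = 0`, turns this into `-⟨X, ∇̃_Z Z⟩ = ⟨∇̃_Z X, Z⟩ = l |Z|²`.

Using holomorphy: `JX` is again tangent to the first factor, so `∇̃_Z (JX)` is a vector of that
factor plus a multiple of `Z`. Both are orthogonal to `JZ`: the first because `J` preserves the
first factor, the second because `J` is skew. Hence `l |Z|² = 0` and `X(f₂) = 0`; connectedness
finishes.

`fderiv_warping_eq_zero` is this argument at one point, in coordinates. It needs only a metric
matrix `G`, Christoffel symbols `Γ` that are symmetric and compatible with `G`, and the matrix of
`J`; the later lemmas extract these data from the manifolds. -/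

/-- A differentiable function that is constant along a line segment has zero derivative in that
direction. -/
lemma fderiv_apply_eq_of_line {P : Type*} [NormedAddCommGroup P] [NormedSpace ℝ P]
    {m : P → ℝ} {z c : P} (hm : DifferentiableAt ℝ m z) {r : ℝ → ℝ} {r' : ℝ}
    (hr : HasDerivAt r r' 0) (h : ∀ᶠ t : ℝ in 𝓝 0, m (z + t • c) = r t) :
    fderiv ℝ m z c = r' := by
  have h1 : HasDerivAt (fun t : ℝ ↦ z + t • c) c 0 := by
    simpa using ((hasDerivAt_id (0 : ℝ)).smul_const c).const_add z
  have h2 : HasFDerivAt m (fderiv ℝ m z) (z + (0 : ℝ) • c) := by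
    simpa using hm.hasFDerivAt
  exact (h2.comp_hasDerivAt (0 : ℝ) h1).unique (hr.congr_of_eventuallyEq h)

lemma eventually_line {P : Type*} [NormedAddCommGroup P] [NormedSpace ℝ P] {z : P} (c : P)
    {p : P → Prop} (h : ∀ᶠ x in 𝓝 z, p x) : ∀ᶠ t : ℝ in 𝓝 0, p (z + t • c) := by
  have h1 : Tendsto (fun t : ℝ ↦ z + t • c) (𝓝 0) (𝓝 z) := by
    have : Continuous (fun t : ℝ ↦ z + t • c) := by fun_prop
    simpa using this.tendsto 0
  exact h1.eventually h

section

variable {P Q E : Type*} [NormedAddCommGroup P] [NormedSpace ℝ P]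
  [NormedAddCommGroup Q] [NormedSpace ℝ Q]
  [NormedAddCommGroup E] [NormedSpace ℝ E]

/-- A section of the image of a family of linear maps, injective at `z`, that vanishes at `z` has
derivative in the image of the linear map at `z`. -/
lemma fderiv_mem_range_of_mem_range [FiniteDimensional ℝ Q] [FiniteDimensional ℝ E]
    {A : P → Q →L[ℝ] E} {s : P → E} {z : P}
    (hA : DifferentiableAt ℝ A z) (hs : DifferentiableAt ℝ s z) (hinj : Function.Injective (A z))
    (hz : s z = 0) (h : ∀ᶠ x in 𝓝 z, ∃ c, s x = A x c) (w : P) :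
    ∃ c, fderiv ℝ s z w = A z c := by
  -- With `L` a left inverse of `A z`, the map `B x = L ∘ A x` is invertible near `z`, so the
  -- coefficients of `s` are `B⁻¹ L s`, hence differentiable. In the product rule the term that
  -- differentiates `A` drops out because `s z = 0`.
  obtain ⟨L₀, hL₀⟩ := (A z).toLinearMap.exists_leftInverse_of_injective
    (LinearMap.ker_eq_bot.mpr hinj)
  let L : E →L[ℝ] Q := LinearMap.toContinuousLinearMap L₀
  have hL : L.comp (A z) = 1 := by
    ext v; exact LinearMap.congr_fun hL₀ v
  let B : P → Q →L[ℝ] Q := fun x ↦ L.comp (A x)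
  have hB : DifferentiableAt ℝ B z := by fun_prop
  have hBz : B z = ((1 : (Q →L[ℝ] Q)ˣ) : Q →L[ℝ] Q) := hL
  have hinv : DifferentiableAt ℝ (fun x ↦ Ring.inverse (B x)) z := by
    have := differentiableAt_inverse (𝕜 := ℝ) (x := B z) (hBz ▸ Units.isUnit _)
    exact this.comp z hB
  have hunit : ∀ᶠ x in 𝓝 z, IsUnit (B x) := by
    have := hB.continuousAt.tendsto
    rw [hBz] at this
    exact this.eventually (Units.nhds (1 : (Q →L[ℝ] Q)ˣ))
  have heq : s =ᶠ[𝓝 z] fun x ↦ A x (Ring.inverse (B x) (L (s x))) := by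
    filter_upwards [h, hunit] with x ⟨c, hc⟩ hx
    have h1 : L (s x) = B x c := by rw [hc]; rfl
    have h2 : Ring.inverse (B x) (B x c) = c := by
      rw [← mul_apply_eq_comp, Ring.inverse_mul_cancel _ hx]; rfl
    rw [h1, h2, hc]
  have hd : DifferentiableAt ℝ (fun x ↦ Ring.inverse (B x) (L (s x))) z := by fun_prop
  refine ⟨fderiv ℝ (fun x ↦ Ring.inverse (B x) (L (s x))) z w, ?_⟩
  rw [heq.fderiv_eq, (hA.hasFDerivAt.clm_apply hd.hasFDerivAt).fderiv]
  simp [hz]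

/-- Compatibility of the metric with covariant differentiation along a map, in coordinates. -/
lemma fderiv_metric_along {G : E → E →L[ℝ] E →L[ℝ] ℝ} {F V W : P → E} {z : P}
    (hG : DifferentiableAt ℝ G (F z)) (hF : DifferentiableAt ℝ F z)
    (hV : DifferentiableAt ℝ V z) (hW : DifferentiableAt ℝ W z)
    {Γ : E → E → E}
    (hΓ : ∀ u v w, fderiv ℝ G (F z) u v w = G (F z) (Γ u v) w + G (F z) v (Γ u w)) (c : P) :
    fderiv ℝ (fun x ↦ G (F x) (V x) (W x)) z c =
      G (F z) (fderiv ℝ V z c + Γ (fderiv ℝ F z c) (V z)) (W z) +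
        G (F z) (V z) (fderiv ℝ W z c + Γ (fderiv ℝ F z c) (W z)) := by
  have h0 : HasFDerivAt (fun x ↦ G (F x)) _ z :=
    HasFDerivAt.comp (G := E →L[ℝ] E →L[ℝ] ℝ) z hG.hasFDerivAt hF.hasFDerivAt
  have h1 := HasFDerivAt.clm_apply (G := E) (H := E →L[ℝ] ℝ) h0 hV.hasFDerivAt
  have h2 := HasFDerivAt.clm_apply h1 hW.hasFDerivAt
  rw [h2.fderiv]
  simp [hΓ]
  ring

end

/-! ### The main argument in coordinates. -/

section

variable {E₀ E₁ E₂ E : Type*}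
  [NormedAddCommGroup E₀] [NormedSpace ℝ E₀] [FiniteDimensional ℝ E₀]
  [NormedAddCommGroup E₁] [NormedSpace ℝ E₁]
  [NormedAddCommGroup E₂] [NormedSpace ℝ E₂]
  [NormedAddCommGroup E] [NormedSpace ℝ E] [FiniteDimensional ℝ E]

/-- In coordinates: along a mixed totally geodesic bi-warped product immersion whose first factor
is holomorphic in a nearly Kaehler manifold, the warping function of the third factor has zero
derivative. -/
theorem fderiv_warping_eq_zero [Nontrivial E₂]
    {F : E₀ × E₁ × E₂ → E} {G : E → E →L[ℝ] E →L[ℝ] ℝ} {J : E → E →L[ℝ] E} {Γ : E → E → E}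
    {z : E₀ × E₁ × E₂}
    {g₀ : E₀ → E₀ →L[ℝ] E₀ →L[ℝ] ℝ} {g₁ : E₁ → E₁ →L[ℝ] E₁ →L[ℝ] ℝ}
    {g₂ : E₂ → E₂ →L[ℝ] E₂ →L[ℝ] ℝ} {f₁ f₂ : E₀ → ℝ}
    (hF : ContDiffAt ℝ ∞ F z) (hG : DifferentiableAt ℝ G (F z)) (hJ : DifferentiableAt ℝ J (F z))
    (hf₂ : DifferentiableAt ℝ f₂ z.1) (hf₂0 : 0 < f₂ z.1)
    (hpos : ∀ v, G (F z) v v = 0 → v = 0)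
    (hpos₀ : ∀ v, g₀ z.1 v v = 0 → v = 0) (hpos₂ : ∀ v, g₂ z.2.2 v v = 0 → v = 0)
    (hsymm : ∀ u v, G (F z) u v = G (F z) v u)
    (hΓsymm : ∀ u v, Γ u v = Γ v u)
    (hΓ : ∀ u v w, fderiv ℝ G (F z) u v w = G (F z) (Γ u v) w + G (F z) v (Γ u w))
    (hJsq : ∀ v, J (F z) (J (F z) v) = -v)
    (hJiso : ∀ᶠ y in 𝓝 (F z), ∀ v w, G y (J y v) (J y w) = G y v w)
    (hnearly : ∀ v, fderiv ℝ J (F z) v v + Γ v (J (F z) v) = J (F z) (Γ v v))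
    (hmetric : ∀ᶠ x in 𝓝 z, ∀ a b, G (F x) (fderiv ℝ F x a) (fderiv ℝ F x b) =
      g₀ x.1 a.1 b.1 + f₁ x.1 ^ 2 * g₁ x.2.1 a.2.1 b.2.1 + f₂ x.1 ^ 2 * g₂ x.2.2 a.2.2 b.2.2)
    (hhol : ∀ᶠ x in 𝓝 z, ∀ u : E₀, ∃ u' : E₀,
      J (F x) (fderiv ℝ F x (u, 0, 0)) = fderiv ℝ F x (u', 0, 0))
    (hmix : ∀ (u : E₀) (w : E₂), ∃ c,
      fderiv ℝ (fderiv ℝ F) z (u, 0, 0) (0, 0, w) +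
        Γ (fderiv ℝ F z (u, 0, 0)) (fderiv ℝ F z (0, 0, w)) = fderiv ℝ F z c) :
    fderiv ℝ f₂ z.1 = 0 := by
  ext u
  obtain ⟨w, hw⟩ := exists_ne (0 : E₂)
  have hFd : DifferentiableAt ℝ F z := hF.differentiableAt (by simp)
  have hDd : DifferentiableAt ℝ (fderiv ℝ F) z :=
    (hF.fderiv_right (m := 1) (by norm_cast)).differentiableAt (by simp)
  have hHs : ∀ a b, fderiv ℝ (fderiv ℝ F) z a b = fderiv ℝ (fderiv ℝ F) z b a :=
    (hF.isSymmSndFDerivAt (by simp; norm_cast)).eq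
  set D := fderiv ℝ F z with hD
  set H := fderiv ℝ (fderiv ℝ F) z with hH
  -- `N a b` is the ambient derivative `∇̃_a (F_* b)` of a constant coordinate field; its symmetry
  -- is the vanishing of torsion.
  set N : E₀ × E₁ × E₂ → E₀ × E₁ × E₂ → E := fun a b ↦ H a b + Γ (D a) (D b) with hN
  have hNs : ∀ a b, N a b = N b a := fun a b ↦ by simp only [hN]; rw [hHs, hΓsymm]
  set m : E₀ × E₁ × E₂ → E₀ × E₁ × E₂ → E₀ × E₁ × E₂ → ℝ :=
    fun a b x ↦ G (F x) (fderiv ℝ F x a) (fderiv ℝ F x b) with hm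
  have hconst : ∀ a, DifferentiableAt ℝ (fun x ↦ fderiv ℝ F x a) z := fun a ↦
    hDd.clm_apply (differentiableAt_const a)
  have hconst' : ∀ a c, fderiv ℝ (fun x ↦ fderiv ℝ F x a) z c = H c a := fun a c ↦ by
    rw [(hDd.hasFDerivAt.clm_apply (hasFDerivAt_const a z)).fderiv]; simp [hH]
  have hGF : DifferentiableAt ℝ (fun x ↦ G (F x)) z :=
    DifferentiableAt.comp (G := E →L[ℝ] E →L[ℝ] ℝ) z hG hFd
  have hJF : DifferentiableAt ℝ (fun x ↦ J (F x)) z := hJ.comp z hFd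
  have hmd : ∀ a b, DifferentiableAt ℝ (m a b) z := fun a b ↦
    DifferentiableAt.clm_apply
      (DifferentiableAt.clm_apply (G := E) (H := E →L[ℝ] ℝ) hGF (hconst a)) (hconst b)
  have hK : ∀ a b c, fderiv ℝ (m a b) z c = G (F z) (N c a) (D b) + G (F z) (D a) (N c b) := by
    intro a b c
    rw [hm, fderiv_metric_along hG hFd (hconst a) (hconst b) hΓ, hconst', hconst']
  have hmet := hmetric.self_of_nhds
  -- the metric components that vanish identically
  have hm02 : ∀ (v : E₀) (w : E₂), m (v, 0, 0) (0, 0, w) =ᶠ[𝓝 z] fun _ ↦ 0 := by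
    intro v w
    filter_upwards [hmetric] with x hx
    simp [hm, hx]
  have hm20 : ∀ (v : E₀) (w : E₂), m (0, 0, w) (v, 0, 0) =ᶠ[𝓝 z] fun _ ↦ 0 := by
    intro v w
    filter_upwards [hmetric] with x hx
    simp [hm, hx]
  have key : ∀ (v : E₀) (w : E₂), N (v, 0, 0) (0, 0, w) =
      (fderiv ℝ f₂ z.1 v / f₂ z.1) • D (0, 0, w) := by
    intro v w
    -- Koszul's formula: `h1 + h2 - h3` isolates twice the left side. Each derivative of a metric
    -- component is taken along a line in a single factor, or is that of an identically zero
    -- component, so no regularity of `g₀`, `g₁`, `g₂` enters.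
    have hb : ∀ b, G (F z) (N (v, 0, 0) (0, 0, w)) (D b) =
        (fderiv ℝ f₂ z.1 v / f₂ z.1) * G (F z) (D (0, 0, w)) (D b) := by
      intro b
      have h1 : fderiv ℝ (m (0, 0, w) b) z (v, 0, 0) =
          2 * f₂ z.1 * fderiv ℝ f₂ z.1 v * g₂ z.2.2 w b.2.2 := by
        have hl : HasDerivAt (fun t : ℝ ↦ f₂ (z.1 + t • v)) (fderiv ℝ f₂ z.1 v) 0 := by
          have h1 : HasDerivAt (fun t : ℝ ↦ z.1 + t • v) v 0 := by
            simpa using ((hasDerivAt_id (0 : ℝ)).smul_const v).const_add z.1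
          have h2 : HasFDerivAt f₂ (fderiv ℝ f₂ z.1) (z.1 + (0 : ℝ) • v) := by
            simpa using hf₂.hasFDerivAt
          exact h2.comp_hasDerivAt (0 : ℝ) h1
        refine fderiv_apply_eq_of_line (hmd _ _)
          (r := fun t ↦ f₂ (z.1 + t • v) ^ 2 * g₂ z.2.2 w b.2.2) ?_ ?_
        · refine ((hl.pow 2).mul_const _).congr_deriv ?_
          simp
        · filter_upwards [eventually_line (v, 0, 0) hmetric] with t ht
          simpa [hm] using ht (0, 0, w) b
      have h2 : fderiv ℝ (m (v, 0, 0) b) z (0, 0, w) = 0 := by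
        refine fderiv_apply_eq_of_line (hmd _ _)
          (r := fun t ↦ g₀ z.1 v b.1) (hasDerivAt_const _ _) ?_
        filter_upwards [eventually_line (0, 0, w) hmetric] with t ht
        simpa [hm] using ht (v, 0, 0) b
      have h3 : fderiv ℝ (m (v, 0, 0) (0, 0, w)) z b = 0 := by
        rw [(hm02 v w).fderiv_eq]; simp
      rw [hK] at h1 h2 h3
      rw [hNs (0, 0, w) (v, 0, 0)] at h2
      rw [hNs b, hNs b] at h3
      have h4 := hmet (0, 0, w) b
      simp only [map_zero, zero_apply, mul_zero, add_zero, zero_add] at h4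
      rw [h4]
      have h5 := hsymm (D (0, 0, w)) (N (v, 0, 0) b)
      have h6 : 2 * G (F z) (N (v, 0, 0) (0, 0, w)) (D b) =
          2 * f₂ z.1 * fderiv ℝ f₂ z.1 v * g₂ z.2.2 w b.2.2 := by linarith
      field_simp
      linarith
    -- By `hmix` the difference of the two sides is tangent, and by `hb` it is orthogonal to every
    -- tangent vector, in particular to itself.
    obtain ⟨c, hc⟩ := hmix v w
    rw [← sub_eq_zero]
    apply hpos
    have : N (v, 0, 0) (0, 0, w) - (fderiv ℝ f₂ z.1 v / f₂ z.1) • D (0, 0, w) =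
        D (c - (fderiv ℝ f₂ z.1 v / f₂ z.1) • ((0, 0, w) : E₀ × E₁ × E₂)) := by
      rw [map_sub, map_smul, ← hc]
    nth_rewrite 2 [this]
    rw [map_sub, map_smul, sub_apply, smul_apply, hb]
    simp
  set X := D (u, 0, 0) with hX
  set Z := D (0, 0, w) with hZ
  set l := fderiv ℝ f₂ z.1 u / f₂ z.1 with hl
  have hZZ : G (F z) Z Z ≠ 0 := by
    rw [hZ, hmet]
    have : g₂ z.2.2 w w ≠ 0 := fun h ↦ hw (hpos₂ w h)
    simp [this, hf₂0.ne']
  have hiso := hJiso.self_of_nhds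
  have hskew : ∀ a b, G (F z) a (J (F z) b) = - G (F z) (J (F z) a) b := by
    intro a b
    have := hiso (J (F z) a) b
    rw [hJsq] at this
    simp at this; linarith
  -- `⟨∇_Z Z, X⟩ = - l ⟨Z, Z⟩`
  have hB : G (F z) X (N (0, 0, w) (0, 0, w)) = - (l * G (F z) Z Z) := by
    have h1 : fderiv ℝ (m (0, 0, w) (u, 0, 0)) z (0, 0, w) = 0 := by
      rw [(hm20 u w).fderiv_eq]; simp
    rw [hK, hNs (0, 0, w) (u, 0, 0), key] at h1
    rw [hsymm]
    simp only [map_smul, smul_eq_mul] at h1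
    linarith
  -- covariant derivatives of `JX` and `JZ`
  have hJd : ∀ a, DifferentiableAt ℝ (fun x ↦ J (F x) (fderiv ℝ F x a)) z := fun a ↦
    hJF.clm_apply (hconst a)
  have hJZ : fderiv ℝ (fun x ↦ J (F x) (fderiv ℝ F x (0, 0, w))) z (0, 0, w) + Γ Z (J (F z) Z) =
      J (F z) (N (0, 0, w) (0, 0, w)) := by
    have h1 : HasFDerivAt (fun x ↦ J (F x) (fderiv ℝ F x (0, 0, w))) _ z :=
      (hJ.hasFDerivAt.comp z hFd.hasFDerivAt).clm_apply (hconst (0, 0, w)).hasFDerivAt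
    rw [h1.fderiv]
    have h2 := hnearly Z
    simp only [Function.comp_apply, add_apply, ContinuousLinearMap.comp_apply,
      ContinuousLinearMap.flip_apply, hconst']
    simp only [hN, map_add]
    rw [← h2]
    abel
  -- Differentiate `⟨JX, JZ⟩ = ⟨X, Z⟩ = 0` along `Z`, then use `hJZ` and the isometry of `J` to
  -- reduce the other term to `hB`.
  have hC : G (F z) (fderiv ℝ (fun x ↦ J (F x) (fderiv ℝ F x (u, 0, 0))) z (0, 0, w) +
      Γ Z (J (F z) X)) (J (F z) Z) = l * G (F z) Z Z := by
    have h1 := fderiv_metric_along hG hFd (hJd (u, 0, 0)) (hJd (0, 0, w)) hΓ (0, 0, w)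
    have h2 : (fun x ↦ G (F x) (J (F x) (fderiv ℝ F x (u, 0, 0)))
        (J (F x) (fderiv ℝ F x (0, 0, w)))) =ᶠ[𝓝 z] fun _ ↦ 0 := by
      filter_upwards [hm02 u w, hFd.continuousAt.eventually hJiso] with x hx hx'
      rw [hx', ← hx]
    rw [h2.fderiv_eq] at h1
    simp only [← hD, ← hZ, ← hX] at h1
    rw [hJZ, hiso, hB] at h1
    simp at h1 ⊢
    linarith
  -- `∇_Z (JX)` is tangent, with no component along `JZ`
  obtain ⟨u', hu'⟩ := hhol.self_of_nhds u
  let ι : E₀ →L[ℝ] E₀ × E₁ × E₂ := ContinuousLinearMap.inl ℝ E₀ (E₁ × E₂)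
  have hι : ∀ v, ι v = (v, 0, 0) := fun v ↦ rfl
  -- Freezing the components `u'` of `JX` at `z` leaves a section of the first factor that vanishes
  -- at `z`. Its derivative stays in that factor, while the frozen field is differentiated by `key`.
  obtain ⟨c, hc⟩ := fderiv_mem_range_of_mem_range (z := z)
    (A := fun x ↦ (fderiv ℝ F x).comp ι)
    (s := fun x ↦ J (F x) (fderiv ℝ F x (u, 0, 0)) - fderiv ℝ F x (u', 0, 0))
    (by fun_prop) ((hJd _).sub (hconst _))
    (by
      rw [injective_iff_map_eq_zero]
      intro v hv
      apply hpos₀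
      have := hmet (v, 0, 0) (v, 0, 0)
      have hv' : fderiv ℝ F z (v, 0, 0) = 0 := hv
      simpa [hv'] using this.symm)
    (by rw [hu', sub_self])
    (by
      filter_upwards [hhol] with x hx
      obtain ⟨v, hv⟩ := hx u
      refine ⟨v - u', ?_⟩
      rw [hv, ContinuousLinearMap.comp_apply, map_sub, map_sub]; rfl)
    (0, 0, w)
  have hsub : fderiv ℝ (fun x ↦ J (F x) (fderiv ℝ F x (u, 0, 0)) - fderiv ℝ F x (u', 0, 0)) z =
      _ := ((hJd (u, 0, 0)).hasFDerivAt.sub (hconst (u', 0, 0)).hasFDerivAt).fderiv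
  rw [hsub, sub_apply, hconst', sub_eq_iff_eq_add,
    ContinuousLinearMap.comp_apply, hι] at hc
  have hu'' : J (F z) X = D (u', 0, 0) := hu'
  rw [hc, hu'', add_assoc] at hC
  have hkey' : H (0, 0, w) (u', 0, 0) + Γ Z (D (u', 0, 0)) =
      (fderiv ℝ f₂ z.1 u' / f₂ z.1) • Z := by
    rw [← key, hNs]
  rw [hkey'] at hC
  have hZJZ : G (F z) Z (J (F z) Z) = 0 := by
    have := hskew Z Z
    rw [hsymm (J (F z) Z)] at this
    linarith
  have hcJZ : G (F z) (D (c, 0, 0)) (J (F z) Z) = 0 := by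
    obtain ⟨c', hc'⟩ := hhol.self_of_nhds c
    rw [hskew, hc']
    have := (hm02 c' w).self_of_nhds
    simpa [hm] using this
  rw [map_add, map_smul, add_apply, smul_apply, hZJZ,
    ← hD, hcJZ] at hC
  have hl0 : l = 0 := by
    have h0 : l * G (F z) Z Z = 0 := by rw [← hC]; simp
    exact (mul_eq_zero.mp h0).resolve_right hZZ
  rw [hl, div_eq_zero_iff] at hl0
  simpa using hl0.resolve_right hf₂0.ne'

end

/-! ### Charts and fields with constant components. -/

section Chart

variable {E : Type*} [NormedAddCommGroup E] [NormedSpace ℝ E]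
  {H : Type*} [TopologicalSpace H] {I : ModelWithCorners ℝ E H}
  {M : Type*} [TopologicalSpace M] [ChartedSpace H M]

/-- The derivative at `p` of a vector valued function is computed in the chart at `p`. -/
lemma mfderiv_eq_fderiv_chart [I.Boundaryless] {F : Type*} [NormedAddCommGroup F] [NormedSpace ℝ F]
    {f : M → F}
    {p : M} (hf : MDifferentiableAt I 𝓘(ℝ, F) f p) (u : E) :
    mfderiv I 𝓘(ℝ, F) f p u = fderiv ℝ (f ∘ (extChartAt I p).symm) (extChartAt I p p) u := by
  let A : E →L[ℝ] F := mfderiv I 𝓘(ℝ, F) f p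
  have h : HasFDerivWithinAt (f ∘ (extChartAt I p).symm) A (Set.range I) (extChartAt I p p) :=
    hf.hasMFDerivAt.2
  rw [I.range_eq_univ, hasFDerivWithinAt_univ] at h
  exact congrArg (fun L : E →L[ℝ] F ↦ L u) h.fderiv.symm

lemma eventually_chart_symm {p : M} {P : M → Prop} (h : ∀ᶠ x in 𝓝 p, P x) :
    ∀ᶠ z in 𝓝 (extChartAt I p p), P ((extChartAt I p).symm z) := by
  have := (continuousAt_extChartAt_symm (I := I) p).tendsto
  rw [extChartAt_to_inv] at this
  exact this.eventually h

variable [IsManifold I ∞ M]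

/-- The vector field with constant components `v` in the chart at `q`. -/
def constField (I : ModelWithCorners ℝ E H) [IsManifold I ∞ M]
    (q : M) (v : E) (x : M) :
    TangentSpace I x :=
  (trivializationAt E (TangentSpace I) q).symmL ℝ x v

lemma mfderiv_chart_constField {q x : M} (hx : x ∈ (chartAt H q).source) (v : E) :
    mfderiv I 𝓘(ℝ, E) (extChartAt I q) x (constField I q v x) = v := by
  rw [← TangentBundle.continuousLinearMapAt_trivializationAt hx]
  exact (trivializationAt E (TangentSpace I) q).continuousLinearMapAt_symmL (R := ℝ)
    (by simpa using hx) v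

lemma constField_mfderiv_chart {q x : M} (hx : x ∈ (chartAt H q).source) (v : TangentSpace I x) :
    constField I q (mfderiv I 𝓘(ℝ, E) (extChartAt I q) x v) x = v := by
  rw [← TangentBundle.continuousLinearMapAt_trivializationAt hx]
  exact (trivializationAt E (TangentSpace I) q).symmL_continuousLinearMapAt (R := ℝ)
    (by simpa using hx) v

lemma contMDiffAt_constField {q x : M} (hx : x ∈ (chartAt H q).source) (v : E) :
    ContMDiffAt I I.tangent ∞ (fun x ↦ (⟨x, constField I q v x⟩ : TangentBundle I M)) x := by
  rw [(trivializationAt E (TangentSpace I) q).contMDiffAt_section_iff (by simpa using hx)]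
  refine contMDiffAt_const (c := v) |>.congr_of_eventuallyEq ?_
  filter_upwards [(chartAt H q).open_source.mem_nhds hx] with x hx
  have := (trivializationAt E (TangentSpace I) q).continuousLinearMapAt_symmL (R := ℝ) (b := x)
    (by simpa using hx) v
  rw [Trivialization.continuousLinearMapAt_apply, Trivialization.linearMapAt_apply] at this
  simp only [TangentBundle.trivializationAt_baseSet, hx, if_true] at this
  exact this

variable [I.Boundaryless]

lemma mfderiv_chart_symm {q : M} {y : E} (hy : y ∈ (extChartAt I q).target) :
    mfderiv 𝓘(ℝ, E) I (extChartAt I q).symm y =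
      (trivializationAt E (TangentSpace I) q).symmL ℝ ((extChartAt I q).symm y) := by
  have h := (extChartAt I q).map_target hy
  rw [extChartAt_source] at h
  rw [TangentBundle.symmL_trivializationAt h, I.range_eq_univ, mfderivWithin_univ,
    (extChartAt I q).right_inv hy]

lemma mdifferentiableAt_chart_symm {q : M} {y : E} (hy : y ∈ (extChartAt I q).target) :
    MDifferentiableAt 𝓘(ℝ, E) I (extChartAt I q).symm y := by
  have := mdifferentiableWithinAt_extChartAt_symm (I := I) hy
  rwa [I.range_eq_univ, mdifferentiableWithinAt_univ] at this

lemma injective_mfderiv_chart_symm {q : M} {y : E} (hy : y ∈ (extChartAt I q).target) :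
    Function.Injective (mfderiv 𝓘(ℝ, E) I (extChartAt I q).symm y) := by
  have h := isInvertible_mfderivWithin_extChartAt_symm (I := I) hy
  rw [I.range_eq_univ, mfderivWithin_univ] at h
  exact h.injective

lemma surjective_mfderiv_chart_symm {q : M} {y : E} (hy : y ∈ (extChartAt I q).target) :
    Function.Surjective (mfderiv 𝓘(ℝ, E) I (extChartAt I q).symm y) := by
  have h := isInvertible_mfderivWithin_extChartAt_symm (I := I) hy
  rw [I.range_eq_univ, mfderivWithin_univ] at h
  exact h.surjective

lemma mfderiv_chart_symm_self (q : M) :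
    mfderiv 𝓘(ℝ, E) I (extChartAt I q).symm (extChartAt I q q) = ContinuousLinearMap.id ℝ E := by
  have h := mfderivWithin_range_extChartAt_symm (I := I) (x := q)
  rw [I.range_eq_univ, mfderivWithin_univ] at h
  exact h

/-- The tangent space at `q` is by definition the model space of the chart at `q`, so this chart has
identity derivative there. -/
lemma constField_self (q : M) (v : E) : constField I q v q = v := by
  have h2 : (trivializationAt E (TangentSpace I) q).symmL ℝ q = ContinuousLinearMap.id ℝ E := by
    rw [TangentBundle.symmL_trivializationAt (mem_chart_source H q), I.range_eq_univ,
      mfderivWithin_univ, mfderiv_chart_symm_self]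
  exact congrArg (fun L : E →L[ℝ] E ↦ L v) h2

end Chart

/-! ### The metric and Christoffel symbols in a chart. -/

section Ambient

variable {E : Type*} [NormedAddCommGroup E] [NormedSpace ℝ E]
  {N : Type*} [TopologicalSpace N] [ChartedSpace E N]
  [RiemannianBundle (fun x : N ↦ TangentSpace 𝓘(ℝ, E) x)]

lemma chartMetric_comm (q : N) (y v w : E) : chartMetric q y v w = chartMetric q y w v :=
  real_inner_comm (mfderiv 𝓘(ℝ, E) 𝓘(ℝ, E) (extChartAt 𝓘(ℝ, E) q).symm y w)
    (mfderiv 𝓘(ℝ, E) 𝓘(ℝ, E) (extChartAt 𝓘(ℝ, E) q).symm y v)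

variable [IsManifold 𝓘(ℝ, E) ∞ N]

lemma chartMetric_apply {q : N} {y : E} (hy : y ∈ (extChartAt 𝓘(ℝ, E) q).target) (v w : E) :
    chartMetric q y v w = inner ℝ (constField 𝓘(ℝ, E) q v ((extChartAt 𝓘(ℝ, E) q).symm y))
      (constField 𝓘(ℝ, E) q w ((extChartAt 𝓘(ℝ, E) q).symm y)) := by
  have h : chartMetric q y v w = inner ℝ (mfderiv 𝓘(ℝ, E) 𝓘(ℝ, E) (extChartAt 𝓘(ℝ, E) q).symm y v)
    (mfderiv 𝓘(ℝ, E) 𝓘(ℝ, E) (extChartAt 𝓘(ℝ, E) q).symm y w) := rfl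
  rw [h, mfderiv_chart_symm hy]
  rfl

lemma chartMetric_chart {q n : N} (hn : n ∈ (extChartAt 𝓘(ℝ, E) q).source) (v w : E) :
    chartMetric q (extChartAt 𝓘(ℝ, E) q n) v w =
      inner ℝ (constField 𝓘(ℝ, E) q v n) (constField 𝓘(ℝ, E) q w n) := by
  rw [chartMetric_apply ((extChartAt 𝓘(ℝ, E) q).map_source hn)]
  exact congrArg (fun b : N ↦ inner ℝ (constField 𝓘(ℝ, E) q v b) (constField 𝓘(ℝ, E) q w b))
    ((extChartAt 𝓘(ℝ, E) q).left_inv hn)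

lemma chartMetric_chart_self [FiniteDimensional ℝ E] (q : N) (v w : E) :
    chartMetric q (extChartAt 𝓘(ℝ, E) q q) v w = @inner ℝ (TangentSpace 𝓘(ℝ, E) q) _ v w := by
  rw [chartMetric_chart (mem_extChartAt_source q), constField_self, constField_self]

lemma eq_zero_of_chartMetric_self_eq_zero {q : N} {y v : E}
    (hy : y ∈ (extChartAt 𝓘(ℝ, E) q).target) (h : chartMetric q y v v = 0) : v = 0 := by
  have h1 : inner ℝ (mfderiv 𝓘(ℝ, E) 𝓘(ℝ, E) (extChartAt 𝓘(ℝ, E) q).symm y v)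
    (mfderiv 𝓘(ℝ, E) 𝓘(ℝ, E) (extChartAt 𝓘(ℝ, E) q).symm y v) = 0 := h
  rw [inner_self_eq_zero] at h1
  exact (injective_iff_map_eq_zero _).mp (injective_mfderiv_chart_symm hy) v h1

variable [FiniteDimensional ℝ E]

/-- Each matrix entry is the inner product of two smooth constant-component fields, hence smooth on
the chart. -/
lemma differentiableAt_chartMetric
    [hN : IsContMDiffRiemannianBundle 𝓘(ℝ, E) ∞ E (fun x : N ↦ TangentSpace 𝓘(ℝ, E) x)] (q : N) :
    DifferentiableAt ℝ (chartMetric q) (extChartAt 𝓘(ℝ, E) q q) := by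
  have h : ContDiffOn ℝ ∞ (chartMetric q) (extChartAt 𝓘(ℝ, E) q).target := by
    rw [contDiffOn_clm_apply]
    intro v
    rw [contDiffOn_clm_apply]
    intro w
    have h1 : ContMDiffOn 𝓘(ℝ, E) 𝓘(ℝ, ℝ) ∞ (fun n : N ↦ inner ℝ (constField 𝓘(ℝ, E) q v n)
        (constField 𝓘(ℝ, E) q w n)) (chartAt E q).source := by
      intro n hn
      have hv := contMDiffAt_constField (I := 𝓘(ℝ, E)) hn v
      have hw := contMDiffAt_constField (I := 𝓘(ℝ, E)) hn w
      exact (ContMDiffAt.inner_bundle (h := hN) hv hw).contMDiffWithinAt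
    rw [← extChartAt_source 𝓘(ℝ, E)] at h1
    have h2 := h1.comp (contMDiffOn_extChartAt_symm (I := 𝓘(ℝ, E)) (n := ∞) q)
      (extChartAt 𝓘(ℝ, E) q).mapsTo_symm
    rw [contMDiffOn_iff_contDiffOn] at h2
    exact h2.congr fun y hy ↦ chartMetric_apply hy v w
  exact (h.contDiffAt ((isOpen_extChartAt_target q).mem_nhds
    (mem_extChartAt_target q))).differentiableAt (by simp)

lemma fderiv_chartMetric_comm
    [IsContMDiffRiemannianBundle 𝓘(ℝ, E) ∞ E (fun x : N ↦ TangentSpace 𝓘(ℝ, E) x)] (q : N)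
    (u v w : E) : fderiv ℝ (chartMetric q) (extChartAt 𝓘(ℝ, E) q q) u v w =
      fderiv ℝ (chartMetric q) (extChartAt 𝓘(ℝ, E) q q) u w v := by
  have h : ∀ v w, fderiv ℝ (fun y ↦ chartMetric q y v w) (extChartAt 𝓘(ℝ, E) q q) u =
      fderiv ℝ (chartMetric q) (extChartAt 𝓘(ℝ, E) q q) u v w := by
    intro v w
    have h1 := HasFDerivAt.clm_apply (G := E) (H := E →L[ℝ] ℝ)
      (differentiableAt_chartMetric q).hasFDerivAt (hasFDerivAt_const v _)
    have h2 := h1.clm_apply (hasFDerivAt_const w _)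
    rw [h2.fderiv]
    simp
  rw [← h, ← h]
  simp_rw [chartMetric_comm q _ v w]

/-- The Christoffel symbols at `q`, as a map on the coordinate space. -/
def chartChristoffel (q : N) (u v : E) : E :=
  christoffel (E := E) q u v

/-- The Riesz isomorphism defining `christoffel` is inverted by pairing with the metric at `q`. -/
lemma chartMetric_chartChristoffel (q : N) (u v w : E) :
    chartMetric q (extChartAt 𝓘(ℝ, E) q q) (chartChristoffel q u v) w =
      (1 / 2 : ℝ) * (fderiv ℝ (chartMetric q) (extChartAt 𝓘(ℝ, E) q q) u v w +
        fderiv ℝ (chartMetric q) (extChartAt 𝓘(ℝ, E) q q) v u w -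
        fderiv ℝ (chartMetric q) (extChartAt 𝓘(ℝ, E) q q) w u v) := by
  rw [chartMetric_chart_self]
  exact InnerProductSpace.toDual_symm_apply (𝕜 := ℝ) (E := TangentSpace 𝓘(ℝ, E) q) (x := w)
    (y := christoffelFirst (E := E) (chartMetric q) (extChartAt 𝓘(ℝ, E) q q) u v)

variable [IsContMDiffRiemannianBundle 𝓘(ℝ, E) ∞ E (fun x : N ↦ TangentSpace 𝓘(ℝ, E) x)]

lemma chartChristoffel_comm (q : N) (u v : E) :
    chartChristoffel q u v = chartChristoffel q v u := by
  rw [← sub_eq_zero]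
  refine eq_zero_of_chartMetric_self_eq_zero (mem_extChartAt_target q) ?_
  have h : ∀ w, chartMetric q (extChartAt 𝓘(ℝ, E) q q)
      (chartChristoffel q u v - chartChristoffel q v u) w = 0 := by
    intro w
    rw [map_sub, sub_apply, chartMetric_chartChristoffel, chartMetric_chartChristoffel,
      fderiv_chartMetric_comm q w u v]
    ring
  exact h _

/-- Metric compatibility: in the sum of the two Christoffel expressions the derivatives in
directions `v` and `w` cancel by symmetry of the metric. -/
lemma fderiv_chartMetric (q : N) (u v w : E) :
    fderiv ℝ (chartMetric q) (extChartAt 𝓘(ℝ, E) q q) u v w =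
      chartMetric q (extChartAt 𝓘(ℝ, E) q q) (chartChristoffel q u v) w +
        chartMetric q (extChartAt 𝓘(ℝ, E) q q) v (chartChristoffel q u w) := by
  rw [chartMetric_comm q _ v, chartMetric_chartChristoffel,
    chartMetric_chartChristoffel, fderiv_chartMetric_comm q u w v, fderiv_chartMetric_comm q w u v]
  ring

end Ambient

/-! ### Covariant derivatives along an immersion, in charts. -/

section Along

variable {E : Type*} [NormedAddCommGroup E] [NormedSpace ℝ E]
  {N : Type*} [TopologicalSpace N] [ChartedSpace E N]
  {EM : Type*} [NormedAddCommGroup EM] [NormedSpace ℝ EM]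
  {HM : Type*} [TopologicalSpace HM] {IM : ModelWithCorners ℝ EM HM}
  {M : Type*} [TopologicalSpace M] [ChartedSpace HM M]

variable (IM) in
/-- The map `i` read in the charts at `p` and at `i p`. -/
def chartMap (i : M → N) (p : M) (z : EM) : E :=
  extChartAt 𝓘(ℝ, E) (i p) (i ((extChartAt IM p).symm z))

lemma contDiffAt_chartMap [IM.Boundaryless] {i : M → N} {p : M} (hi : ContMDiffAt IM 𝓘(ℝ, E) ∞ i p) :
    ContDiffAt ℝ ∞ (chartMap (E := E) IM i p) (extChartAt IM p p) := by
  have h := (contMDiffAt_iff.mp hi).2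
  rw [IM.range_eq_univ, contDiffWithinAt_univ] at h
  exact h

lemma chartMap_self (i : M → N) (p : M) :
    chartMap (E := E) IM i p (extChartAt IM p p) = extChartAt 𝓘(ℝ, E) (i p) (i p) := by
  rw [chartMap, extChartAt_to_inv]

/-- The covariant derivative along `i` of a vector field whose components in the chart at `i p`
are `W`. -/
lemma covDerivAlong_eq [IM.Boundaryless] [FiniteDimensional ℝ E]
    [RiemannianBundle (fun x : N ↦ TangentSpace 𝓘(ℝ, E) x)] {i : M → N}
    {V : ∀ x : M, TangentSpace 𝓘(ℝ, E) (i x)} {p : M} {W : M → E}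
    (hW : MDifferentiableAt IM 𝓘(ℝ, E) W p)
    (h : ∀ᶠ x in 𝓝 p, mfderiv 𝓘(ℝ, E) 𝓘(ℝ, E) (extChartAt 𝓘(ℝ, E) (i p)) (i x) (V x) = W x)
    (u : EM) :
    covDerivAlong IM i V p u =
      (fderiv ℝ (W ∘ (extChartAt IM p).symm) (extChartAt IM p p) u +
        chartChristoffel (E := E) (i p) (mfderiv IM 𝓘(ℝ, E) i p u) (V p) : E) := by
  rw [← mfderiv_eq_fderiv_chart hW]
  let Vφ : M → E := fun x ↦ mfderiv 𝓘(ℝ, E) 𝓘(ℝ, E) (extChartAt 𝓘(ℝ, E) (i p)) (i x) (V x)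
  have h1 : Vφ =ᶠ[𝓝 p] W := h
  have h2 : @Eq E (mfderiv IM 𝓘(ℝ, E) Vφ p u) (mfderiv IM 𝓘(ℝ, E) W p u) :=
    congrArg (fun L : EM →L[ℝ] E ↦ L u) (hW.hasMFDerivAt.congr_of_eventuallyEq h1).mfderiv
  exact congrArg (fun v : E ↦ v + chartChristoffel (E := E) (i p) (mfderiv IM 𝓘(ℝ, E) i p u) (V p)) h2

variable [IM.Boundaryless] [IsManifold 𝓘(ℝ, E) ∞ N] [IsManifold IM ∞ M]

lemma fderiv_chartMap {i : M → N} (hi : MDifferentiable IM 𝓘(ℝ, E) i) {p : M} {z : EM}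
    (hz : z ∈ (extChartAt IM p).target)
    (hiz : i ((extChartAt IM p).symm z) ∈ (chartAt E (i p)).source) (a : EM) :
    fderiv ℝ (chartMap (E := E) IM i p) z a =
      mfderiv 𝓘(ℝ, E) 𝓘(ℝ, E) (extChartAt 𝓘(ℝ, E) (i p)) (i ((extChartAt IM p).symm z))
        (mfderiv IM 𝓘(ℝ, E) i ((extChartAt IM p).symm z)
          (mfderiv 𝓘(ℝ, EM) IM (extChartAt IM p).symm z a)) := by
  have h1 := (mdifferentiableAt_chart_symm hz).hasMFDerivAt
  have h2 := (hi ((extChartAt IM p).symm z)).hasMFDerivAt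
  have h3 := (mdifferentiableAt_extChartAt (I := 𝓘(ℝ, E)) hiz).hasMFDerivAt
  have h4 := h3.comp z (h2.comp z h1)
  rw [hasMFDerivAt_iff_hasFDerivAt] at h4
  let A : EM →L[ℝ] E :=
    (mfderiv 𝓘(ℝ, E) 𝓘(ℝ, E) (extChartAt 𝓘(ℝ, E) (i p)) (i ((extChartAt IM p).symm z))).comp
      ((mfderiv IM 𝓘(ℝ, E) i ((extChartAt IM p).symm z)).comp
        (mfderiv 𝓘(ℝ, EM) IM (extChartAt IM p).symm z))
  have h5 : HasFDerivAt (chartMap (E := E) IM i p) A z := h4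
  exact congrArg (fun L : EM →L[ℝ] E ↦ L a) h5.fderiv

lemma fderiv_chartMap_chart {i : M → N} (hi : MDifferentiable IM 𝓘(ℝ, E) i) {p x : M}
    (hx : x ∈ (extChartAt IM p).source) (hix : i x ∈ (chartAt E (i p)).source) (a : EM) :
    fderiv ℝ (chartMap (E := E) IM i p) (extChartAt IM p x) a =
      mfderiv 𝓘(ℝ, E) 𝓘(ℝ, E) (extChartAt 𝓘(ℝ, E) (i p)) (i x)
        (mfderiv IM 𝓘(ℝ, E) i x (constField IM p a x)) := by
  have hl := (extChartAt IM p).left_inv hx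
  rw [fderiv_chartMap hi ((extChartAt IM p).map_source hx) (by rwa [hl]),
    mfderiv_chart_symm ((extChartAt IM p).map_source hx)]
  exact congrArg (fun b : M ↦ (mfderiv 𝓘(ℝ, E) 𝓘(ℝ, E) (extChartAt 𝓘(ℝ, E) (i p)) (i b)
        (mfderiv IM 𝓘(ℝ, E) i b (constField IM p a b)) : E)) hl

lemma fderiv_chartMap_self {i : M → N} (hi : MDifferentiable IM 𝓘(ℝ, E) i) (p : M) (a : EM) :
    fderiv ℝ (chartMap (E := E) IM i p) (extChartAt IM p p) a = mfderiv IM 𝓘(ℝ, E) i p a := by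
  rw [fderiv_chartMap_chart hi (mem_extChartAt_source p) (mem_chart_source E (i p)),
    mfderiv_extChartAt_self, constField_self]
  rfl

variable [FiniteDimensional ℝ E] [RiemannianBundle (fun x : N ↦ TangentSpace 𝓘(ℝ, E) x)]

/-- Turns `h = 0` into the form used by `fderiv_warping_eq_zero`: the covariant derivative is
tangent. -/
lemma exists_of_secondFundamentalForm_eq_zero {i : M → N} (hi : ContMDiff IM 𝓘(ℝ, E) ∞ i) {p : M}
    {a b : EM}
    (h : secondFundamentalForm (E := E) IM i (constField IM p a) (constField IM p b) p = 0) :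
    ∃ c, fderiv ℝ (fderiv ℝ (chartMap (E := E) IM i p)) (extChartAt IM p p) a b +
      chartChristoffel (E := E) (i p) (fderiv ℝ (chartMap (E := E) IM i p) (extChartAt IM p p) a)
        (fderiv ℝ (chartMap (E := E) IM i p) (extChartAt IM p p) b) =
      fderiv ℝ (chartMap (E := E) IM i p) (extChartAt IM p p) c := by
  have hid : MDifferentiable IM 𝓘(ℝ, E) i := hi.mdifferentiable (by simp)
  have hD : DifferentiableAt ℝ (fderiv ℝ (chartMap (E := E) IM i p)) (extChartAt IM p p) :=
    ((contDiffAt_chartMap (hi p)).fderiv_right (m := 1) (by norm_cast)).differentiableAt (by simp)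
  have hDb := hD.hasFDerivAt.clm_apply (hasFDerivAt_const b _)
  let W : M → E := fun x ↦ fderiv ℝ (chartMap (E := E) IM i p) (extChartAt IM p x) b
  have hW : MDifferentiableAt IM 𝓘(ℝ, E) W p :=
    (hDb.differentiableAt.mdifferentiableAt).comp p
      (mdifferentiableAt_extChartAt (I := IM) (mem_chart_source HM p))
  -- A vanishing normal component means lying in the double orthogonal complement of the tangent
  -- space, which is the tangent space itself.
  rw [secondFundamentalForm, Submodule.starProjection_apply_eq_zero_iff,
    Submodule.orthogonal_orthogonal] at h
  obtain ⟨c, hc⟩ := h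
  have hcov := covDerivAlong_eq hW (i := i) (p := p)
    (V := fun x ↦ mfderiv IM 𝓘(ℝ, E) i x (constField IM p b x)) (by
      filter_upwards [extChartAt_source_mem_nhds (I := IM) p,
        (hi p).continuousAt.eventually ((chartAt E (i p)).open_source.mem_nhds
          (mem_chart_source E (i p)))] with x hx hix
      exact (fderiv_chartMap_chart hid hx hix b).symm) a
  refine ⟨c, ?_⟩
  have hWs : W ∘ (extChartAt IM p).symm =ᶠ[𝓝 (extChartAt IM p p)]
      fun z ↦ fderiv ℝ (chartMap (E := E) IM i p) z b := by
    filter_upwards [extChartAt_target_mem_nhds (I := IM) p] with z hz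
    simp only [W, Function.comp_apply, (extChartAt IM p).right_inv hz]
  rw [hWs.fderiv_eq, hDb.fderiv] at hcov
  simp only [constField_self] at hcov hc
  rw [fderiv_chartMap_self hid p c, fderiv_chartMap_self hid p a,
    fderiv_chartMap_self hid p b]
  refine Eq.trans ?_ (hcov.symm.trans hc.symm)
  simp

end Along

/-! ### The almost complex structure in a chart. -/

section End

variable {E : Type*} [NormedAddCommGroup E] [NormedSpace ℝ E]
  {N : Type*} [TopologicalSpace N] [ChartedSpace E N] [IsManifold 𝓘(ℝ, E) ∞ N]

/-- The matrix of `J n` in the chart at `q`. -/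
def chartEnd (J : ∀ x : N, TangentSpace 𝓘(ℝ, E) x →L[ℝ] TangentSpace 𝓘(ℝ, E) x) (q n : N) :
    E →L[ℝ] E :=
  ContinuousLinearMap.inCoordinates E (TangentSpace 𝓘(ℝ, E)) E (TangentSpace 𝓘(ℝ, E)) q n q n (J n)

variable {J : ∀ x : N, TangentSpace 𝓘(ℝ, E) x →L[ℝ] TangentSpace 𝓘(ℝ, E) x}

lemma chartEnd_apply {q n : N} (hn : n ∈ (chartAt E q).source) (v : E) :
    chartEnd J q n v = mfderiv 𝓘(ℝ, E) 𝓘(ℝ, E) (extChartAt 𝓘(ℝ, E) q) n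
      (J n (constField 𝓘(ℝ, E) q v n)) := by
  rw [← TangentBundle.continuousLinearMapAt_trivializationAt hn]
  rfl

lemma constField_chartEnd {q n : N} (hn : n ∈ (chartAt E q).source) (v : E) :
    constField 𝓘(ℝ, E) q (chartEnd J q n v) n = J n (constField 𝓘(ℝ, E) q v n) := by
  rw [chartEnd_apply hn, constField_mfderiv_chart hn]

lemma chartEnd_self (q : N) (v : E) : chartEnd J q q v = J q v := by
  rw [← constField_self (I := 𝓘(ℝ, E)) q (chartEnd J q q v),
    constField_chartEnd (mem_chart_source E q), constField_self]

lemma chartEnd_mfderiv_chart {q n : N} (hn : n ∈ (chartAt E q).source)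
    (v : TangentSpace 𝓘(ℝ, E) n) :
    chartEnd J q n (mfderiv 𝓘(ℝ, E) 𝓘(ℝ, E) (extChartAt 𝓘(ℝ, E) q) n v) =
      mfderiv 𝓘(ℝ, E) 𝓘(ℝ, E) (extChartAt 𝓘(ℝ, E) q) n (J n v) := by
  refine (chartEnd_apply hn _).trans ?_
  rw [constField_mfderiv_chart hn]

variable [FiniteDimensional ℝ E] [RiemannianBundle (fun x : N ↦ TangentSpace 𝓘(ℝ, E) x)]

namespace IsNearlyKaehler

lemma mdifferentiableAt_chartEnd (hJ : IsNearlyKaehler J) (q : N) :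
    MDifferentiableAt 𝓘(ℝ, E) 𝓘(ℝ, E →L[ℝ] E) (chartEnd J q) q := by
  have h := ((contMDiffAt_hom_bundle _).mp (hJ.smooth q)).2
  exact h.mdifferentiableAt (by simp)

lemma differentiableAt_chartEnd (hJ : IsNearlyKaehler J) (q : N) :
    DifferentiableAt ℝ (fun y ↦ chartEnd J q ((extChartAt 𝓘(ℝ, E) q).symm y))
      (extChartAt 𝓘(ℝ, E) q q) := by
  rw [← mdifferentiableAt_iff_differentiableAt]
  have h1 := mdifferentiableAt_chart_symm (mem_extChartAt_target (I := 𝓘(ℝ, E)) q)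
  have h2 := hJ.mdifferentiableAt_chartEnd q
  exact MDifferentiableAt.comp_of_eq (extChartAt 𝓘(ℝ, E) q q) h2 h1 (extChartAt_to_inv q)

lemma chartEnd_sq (hJ : IsNearlyKaehler J) (q : N) (v : E) :
    chartEnd J q q (chartEnd J q q v) = -v := by
  rw [chartEnd_self, chartEnd_self]
  exact hJ.sq q v

lemma chartMetric_chartEnd (hJ : IsNearlyKaehler J) {q n : N}
    (hn : n ∈ (chartAt E q).source) (v w : E) :
    chartMetric q (extChartAt 𝓘(ℝ, E) q n) (chartEnd J q n v) (chartEnd J q n w) =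
      chartMetric q (extChartAt 𝓘(ℝ, E) q n) v w := by
  have hn' := hn
  rw [← extChartAt_source 𝓘(ℝ, E)] at hn'
  rw [chartMetric_chart hn', chartMetric_chart hn', constField_chartEnd hn,
    constField_chartEnd hn, hJ.isometric]

/-- `(∇_v J) v = 0`, in the chart at `q`. -/
lemma fderiv_chartEnd (hJ : IsNearlyKaehler J) (q : N) (v : E) :
    fderiv ℝ (fun y ↦ chartEnd J q ((extChartAt 𝓘(ℝ, E) q).symm y)) (extChartAt 𝓘(ℝ, E) q q) v v +
      chartChristoffel q v (chartEnd J q q v) = chartEnd J q q (chartChristoffel q v v) := by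
  have hs := (chartAt E q).open_source.mem_nhds (mem_chart_source E q)
  have hX := contMDiffAt_constField (I := 𝓘(ℝ, E)) (mem_chart_source E q) v
  have h := hJ.nearly q (constField 𝓘(ℝ, E) q v) (constField 𝓘(ℝ, E) q v) hX hX
  -- With equal fields the two terms of the nearly Kaehler condition coincide, so each is zero.
  rw [← two_smul ℝ, smul_eq_zero_iff_right two_ne_zero, covDerivEnd, sub_eq_zero,
    constField_self] at h
  have h1 := covDerivAlong_eq (IM := 𝓘(ℝ, E)) (i := fun x : N ↦ x) (p := q)
    (V := constField 𝓘(ℝ, E) q v) (W := fun _ ↦ v) mdifferentiableAt_const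
    (by filter_upwards [hs] with x hx; exact mfderiv_chart_constField hx v) v
  have hd := (hJ.differentiableAt_chartEnd q).hasFDerivAt.clm_apply (hasFDerivAt_const v _)
  have h2 := covDerivAlong_eq (IM := 𝓘(ℝ, E)) (i := fun x : N ↦ x) (p := q)
    (V := fun x ↦ J x (constField 𝓘(ℝ, E) q v x)) (W := fun x ↦ chartEnd J q x v)
    ((hJ.mdifferentiableAt_chartEnd q).clm_apply mdifferentiableAt_const)
    (by filter_upwards [hs] with x hx; exact (chartEnd_apply hx v).symm) v
  have h3 : (fun x ↦ chartEnd J q x v) ∘ (extChartAt 𝓘(ℝ, E) q).symm =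
    fun y ↦ chartEnd J q ((extChartAt 𝓘(ℝ, E) q).symm y) v := rfl
  have h4 : (fun _ ↦ v) ∘ (extChartAt 𝓘(ℝ, E) q).symm = fun _ ↦ v := rfl
  have hid : mfderiv 𝓘(ℝ, E) 𝓘(ℝ, E) (fun x : N ↦ x) q v = v := by
    rw [show (fun x : N ↦ x) = id from rfl, mfderiv_id]; rfl
  rw [h3, hd.fderiv, hid, constField_self] at h2
  rw [h4, hid, constField_self] at h1
  rw [chartEnd_self, chartEnd_self]
  have h1' : covDeriv (constField 𝓘(ℝ, E) q v) q v = chartChristoffel q v v := by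
    refine h1.trans ?_
    simp
    rfl
  have h2' : covDeriv (fun x ↦ J x (constField 𝓘(ℝ, E) q v x)) q v = _ := h2
  rw [h1'] at h
  refine Eq.trans ?_ ((h2'.symm.trans h))
  simp

end IsNearlyKaehler

end End

/-! ### Passing from zero derivative to constancy. -/

/-- A differentiable function with zero derivative is constant on a connected manifold. -/
lemma exists_eq_const_of_mfderiv_eq_zero {E : Type*} [NormedAddCommGroup E] [NormedSpace ℝ E]
    {M : Type*} [TopologicalSpace M] [ChartedSpace E M] [IsManifold 𝓘(ℝ, E) ∞ M]
    [PreconnectedSpace M] [Nonempty M] {f : M → ℝ} (hf : MDifferentiable 𝓘(ℝ, E) 𝓘(ℝ, ℝ) f)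
    (h : ∀ a : M, fderiv ℝ (f ∘ (extChartAt 𝓘(ℝ, E) a).symm) (extChartAt 𝓘(ℝ, E) a a) = 0) :
    ∃ c, ∀ a, f a = c := by
  have h0 : ∀ a : M, mfderiv 𝓘(ℝ, E) 𝓘(ℝ, ℝ) f a = 0 := by
    intro a
    ext u
    refine (mfderiv_eq_fderiv_chart (hf a) u).trans ?_
    rw [h]
    rfl
  have hloc : IsLocallyConstant f := by
    rw [IsLocallyConstant.iff_eventually_eq]
    intro a
    set φ := extChartAt 𝓘(ℝ, E) a
    -- A ball inside the chart target is convex, so the mean value inequality makes `f` constant on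
    -- it.
    obtain ⟨r, hr, hball⟩ := Metric.isOpen_iff.mp (isOpen_extChartAt_target (I := 𝓘(ℝ, E)) a)
      (φ a) (mem_extChartAt_target a)
    have hd : ∀ y ∈ Metric.ball (φ a) r, HasFDerivAt (f ∘ φ.symm) (0 : E →L[ℝ] ℝ) y := by
      intro y hy
      have h1 := (mdifferentiableAt_chart_symm (I := 𝓘(ℝ, E)) (hball hy)).hasMFDerivAt
      have h2 := (hf (φ.symm y)).hasMFDerivAt
      rw [h0] at h2
      have h3 := h2.comp y h1
      rw [ContinuousLinearMap.zero_comp] at h3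
      exact hasMFDerivAt_iff_hasFDerivAt.mp h3
    have hc : ∀ y ∈ Metric.ball (φ a) r, (f ∘ φ.symm) y = (f ∘ φ.symm) (φ a) := by
      intro y hy
      refine (convex_ball (φ a) r).is_const_of_fderivWithin_eq_zero (𝕜 := ℝ)
        (fun y hy ↦ (hd y hy).differentiableAt.differentiableWithinAt) ?_ hy
        (Metric.mem_ball_self hr)
      intro y hy
      rw [fderivWithin_of_isOpen Metric.isOpen_ball hy, (hd y hy).fderiv]
    have hev := (continuousAt_extChartAt (I := 𝓘(ℝ, E)) a).eventually
      (Metric.ball_mem_nhds (φ a) hr)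
    filter_upwards [hev, extChartAt_source_mem_nhds (I := 𝓘(ℝ, E)) a] with x hx hxs
    have := hc (φ x) hx
    rwa [Function.comp_apply, Function.comp_apply, (extChartAt 𝓘(ℝ, E) a).left_inv hxs,
      extChartAt_to_inv] at this
  obtain ⟨a₀⟩ := ‹Nonempty M›
  exact ⟨f a₀, fun a ↦ hloc.apply_eq_of_preconnectedSpace a a₀⟩

/-! ### The three distributions in product charts. -/

section BiWarped

variable {E₀ E₁ E₂ : Type*}
  [NormedAddCommGroup E₀] [NormedSpace ℝ E₀]
  [NormedAddCommGroup E₁] [NormedSpace ℝ E₁]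
  [NormedAddCommGroup E₂] [NormedSpace ℝ E₂]
  {M₀ M₁ M₂ : Type*}
  [TopologicalSpace M₀] [ChartedSpace E₀ M₀] [IsManifold 𝓘(ℝ, E₀) ∞ M₀]
  [TopologicalSpace M₁] [ChartedSpace E₁ M₁] [IsManifold 𝓘(ℝ, E₁) ∞ M₁]
  [TopologicalSpace M₂] [ChartedSpace E₂ M₂] [IsManifold 𝓘(ℝ, E₂) ∞ M₂]

lemma dπ₀_mfderiv_chart_symm {p : M₀ × M₁ × M₂} {z : E₀ × E₁ × E₂}
    (hz : z ∈ (extChartAt (tripleModel E₀ E₁ E₂) p).target) (a : E₀ × E₁ × E₂) :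
    dπ₀ ((extChartAt (tripleModel E₀ E₁ E₂) p).symm z)
      (mfderiv 𝓘(ℝ, E₀ × E₁ × E₂) (tripleModel E₀ E₁ E₂)
        (extChartAt (tripleModel E₀ E₁ E₂) p).symm z a) =
      mfderiv 𝓘(ℝ, E₀) 𝓘(ℝ, E₀) (extChartAt 𝓘(ℝ, E₀) p.1).symm z.1 a.1 := by
  have h1 := (mdifferentiableAt_chart_symm hz).hasMFDerivAt
  have h2 : MDifferentiable (tripleModel E₀ E₁ E₂) 𝓘(ℝ, E₀) (fun y : M₀ × M₁ × M₂ ↦ y.1) :=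
    mdifferentiable_fst
  have h3 := (h2 ((extChartAt (tripleModel E₀ E₁ E₂) p).symm z)).hasMFDerivAt.comp z h1
  have hz0 : z.1 ∈ (extChartAt 𝓘(ℝ, E₀) p.1).target := by
    simp only [extChartAt_prod, PartialEquiv.prod_target] at hz
    exact hz.1
  have h4 : HasMFDerivAt 𝓘(ℝ, E₀ × E₁ × E₂) 𝓘(ℝ, E₀) (fun y : E₀ × E₁ × E₂ ↦ y.1) z
    (ContinuousLinearMap.fst ℝ E₀ (E₁ × E₂)) :=
    (ContinuousLinearMap.fst ℝ E₀ (E₁ × E₂)).hasMFDerivAt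
  have h5 := (mdifferentiableAt_chart_symm hz0).hasMFDerivAt.comp z h4
  have h6 := h3.mfderiv.symm.trans h5.mfderiv
  exact congrArg (fun L : E₀ × E₁ × E₂ →L[ℝ] E₀ ↦ L a) h6

lemma dπ₁_mfderiv_chart_symm {p : M₀ × M₁ × M₂} {z : E₀ × E₁ × E₂}
    (hz : z ∈ (extChartAt (tripleModel E₀ E₁ E₂) p).target) (a : E₀ × E₁ × E₂) :
    dπ₁ ((extChartAt (tripleModel E₀ E₁ E₂) p).symm z)
      (mfderiv 𝓘(ℝ, E₀ × E₁ × E₂) (tripleModel E₀ E₁ E₂)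
        (extChartAt (tripleModel E₀ E₁ E₂) p).symm z a) =
      mfderiv 𝓘(ℝ, E₁) 𝓘(ℝ, E₁) (extChartAt 𝓘(ℝ, E₁) p.2.1).symm z.2.1 a.2.1 := by
  have h1 := (mdifferentiableAt_chart_symm hz).hasMFDerivAt
  have h2 : MDifferentiable (tripleModel E₀ E₁ E₂) 𝓘(ℝ, E₁) (fun y : M₀ × M₁ × M₂ ↦ y.2.1) :=
    mdifferentiable_fst.comp mdifferentiable_snd
  have h3 := (h2 ((extChartAt (tripleModel E₀ E₁ E₂) p).symm z)).hasMFDerivAt.comp z h1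
  have hz0 : z.2.1 ∈ (extChartAt 𝓘(ℝ, E₁) p.2.1).target := by
    simp only [extChartAt_prod, PartialEquiv.prod_target] at hz
    exact hz.2.1
  have h4 : HasMFDerivAt 𝓘(ℝ, E₀ × E₁ × E₂) 𝓘(ℝ, E₁) (fun y : E₀ × E₁ × E₂ ↦ y.2.1) z
    ((ContinuousLinearMap.fst ℝ E₁ E₂).comp (ContinuousLinearMap.snd ℝ E₀ (E₁ × E₂))) :=
    ((ContinuousLinearMap.fst ℝ E₁ E₂).comp (ContinuousLinearMap.snd ℝ E₀ (E₁ × E₂))).hasMFDerivAt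
  have h5 := (mdifferentiableAt_chart_symm hz0).hasMFDerivAt.comp z h4
  have h6 := h3.mfderiv.symm.trans h5.mfderiv
  exact congrArg (fun L : E₀ × E₁ × E₂ →L[ℝ] E₁ ↦ L a) h6

lemma dπ₂_mfderiv_chart_symm {p : M₀ × M₁ × M₂} {z : E₀ × E₁ × E₂}
    (hz : z ∈ (extChartAt (tripleModel E₀ E₁ E₂) p).target) (a : E₀ × E₁ × E₂) :
    dπ₂ ((extChartAt (tripleModel E₀ E₁ E₂) p).symm z)
      (mfderiv 𝓘(ℝ, E₀ × E₁ × E₂) (tripleModel E₀ E₁ E₂)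
        (extChartAt (tripleModel E₀ E₁ E₂) p).symm z a) =
      mfderiv 𝓘(ℝ, E₂) 𝓘(ℝ, E₂) (extChartAt 𝓘(ℝ, E₂) p.2.2).symm z.2.2 a.2.2 := by
  have h1 := (mdifferentiableAt_chart_symm hz).hasMFDerivAt
  have h2 : MDifferentiable (tripleModel E₀ E₁ E₂) 𝓘(ℝ, E₂) (fun y : M₀ × M₁ × M₂ ↦ y.2.2) :=
    mdifferentiable_snd.comp mdifferentiable_snd
  have h3 := (h2 ((extChartAt (tripleModel E₀ E₁ E₂) p).symm z)).hasMFDerivAt.comp z h1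
  have hz0 : z.2.2 ∈ (extChartAt 𝓘(ℝ, E₂) p.2.2).target := by
    simp only [extChartAt_prod, PartialEquiv.prod_target] at hz
    exact hz.2.2
  have h4 : HasMFDerivAt 𝓘(ℝ, E₀ × E₁ × E₂) 𝓘(ℝ, E₂) (fun y : E₀ × E₁ × E₂ ↦ y.2.2) z
    ((ContinuousLinearMap.snd ℝ E₁ E₂).comp (ContinuousLinearMap.snd ℝ E₀ (E₁ × E₂))) :=
    ((ContinuousLinearMap.snd ℝ E₁ E₂).comp (ContinuousLinearMap.snd ℝ E₀ (E₁ × E₂))).hasMFDerivAt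
  have h5 := (mdifferentiableAt_chart_symm hz0).hasMFDerivAt.comp z h4
  have h6 := h3.mfderiv.symm.trans h5.mfderiv
  exact congrArg (fun L : E₀ × E₁ × E₂ →L[ℝ] E₂ ↦ L a) h6

/-- A product chart acts factor by factor and each factor's derivative is injective, so a projection
vanishes exactly when the matching coordinate does. -/
lemma mfderiv_chart_symm_mem_dist₀_iff {p : M₀ × M₁ × M₂} {z : E₀ × E₁ × E₂}
    (hz : z ∈ (extChartAt (tripleModel E₀ E₁ E₂) p).target) (a : E₀ × E₁ × E₂) :
    mfderiv 𝓘(ℝ, E₀ × E₁ × E₂) (tripleModel E₀ E₁ E₂)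
        (extChartAt (tripleModel E₀ E₁ E₂) p).symm z a ∈
      dist₀ E₀ E₁ E₂ ((extChartAt (tripleModel E₀ E₁ E₂) p).symm z) ↔ a.2 = 0 := by
  have hz' := hz
  simp only [extChartAt_prod, PartialEquiv.prod_target] at hz'
  have h1 : dπ₁ ((extChartAt (tripleModel E₀ E₁ E₂) p).symm z)
      (mfderiv 𝓘(ℝ, E₀ × E₁ × E₂) (tripleModel E₀ E₁ E₂)
        (extChartAt (tripleModel E₀ E₁ E₂) p).symm z a) = 0 ↔ a.2.1 = 0 := by
    rw [dπ₁_mfderiv_chart_symm hz]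
    exact map_eq_zero_iff _ (injective_mfderiv_chart_symm hz'.2.1)
  have h2 : dπ₂ ((extChartAt (tripleModel E₀ E₁ E₂) p).symm z)
      (mfderiv 𝓘(ℝ, E₀ × E₁ × E₂) (tripleModel E₀ E₁ E₂)
        (extChartAt (tripleModel E₀ E₁ E₂) p).symm z a) = 0 ↔ a.2.2 = 0 := by
    rw [dπ₂_mfderiv_chart_symm hz]
    exact map_eq_zero_iff _ (injective_mfderiv_chart_symm hz'.2.2)
  rw [dist₀, Submodule.mem_inf, LinearMap.mem_ker, LinearMap.mem_ker, Prod.ext_iff]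
  exact and_congr h1 h2

lemma mfderiv_chart_symm_mem_dist₂ {p : M₀ × M₁ × M₂} {z : E₀ × E₁ × E₂}
    (hz : z ∈ (extChartAt (tripleModel E₀ E₁ E₂) p).target) (w : E₂) :
    mfderiv 𝓘(ℝ, E₀ × E₁ × E₂) (tripleModel E₀ E₁ E₂)
        (extChartAt (tripleModel E₀ E₁ E₂) p).symm z (0, 0, w) ∈
      dist₂ E₀ E₁ E₂ ((extChartAt (tripleModel E₀ E₁ E₂) p).symm z) := by
  rw [dist₂, Submodule.mem_inf, LinearMap.mem_ker, LinearMap.mem_ker]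
  exact ⟨(dπ₀_mfderiv_chart_symm hz _).trans (map_zero _),
    (dπ₁_mfderiv_chart_symm hz _).trans (map_zero _)⟩

/-- A constant field in a chart lies in a distribution as soon as it does so inside the chart. -/
lemma constField_mem {p : M₀ × M₁ × M₂} {a : E₀ × E₁ × E₂}
    {D : ∀ x : M₀ × M₁ × M₂, Submodule ℝ (TangentSpace (tripleModel E₀ E₁ E₂) x)}
    (h : ∀ z ∈ (extChartAt (tripleModel E₀ E₁ E₂) p).target,
      mfderiv 𝓘(ℝ, E₀ × E₁ × E₂) (tripleModel E₀ E₁ E₂)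
        (extChartAt (tripleModel E₀ E₁ E₂) p).symm z a ∈
        D ((extChartAt (tripleModel E₀ E₁ E₂) p).symm z)) (x : M₀ × M₁ × M₂) :
    constField (tripleModel E₀ E₁ E₂) p a x ∈ D x := by
  by_cases hx : x ∈ (extChartAt (tripleModel E₀ E₁ E₂) p).source
  · have hz := (extChartAt (tripleModel E₀ E₁ E₂) p).map_source hx
    have h1 := h _ hz
    rw [mfderiv_chart_symm hz] at h1
    have h2 : constField (tripleModel E₀ E₁ E₂) p a
        ((extChartAt (tripleModel E₀ E₁ E₂) p).symm (extChartAt (tripleModel E₀ E₁ E₂) p x)) ∈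
        D ((extChartAt (tripleModel E₀ E₁ E₂) p).symm (extChartAt (tripleModel E₀ E₁ E₂) p x)) := h1
    rwa [(extChartAt (tripleModel E₀ E₁ E₂) p).left_inv hx] at h2
  -- Off the chart domain `symmL` takes the default value zero, so the field lies in the
  -- distribution everywhere, as `IsMixedTotallyGeodesic` demands.
  · have h0 : constField (tripleModel E₀ E₁ E₂) p a x = 0 := by
      rw [extChartAt_source] at hx
      exact Trivialization.symmL_apply_of_notMem _ (by simpa using hx) a
    rw [h0]
    exact zero_mem _

end BiWarped

end NearlyKaehler

end

/-! ### The theorem, by transfer to coordinates. -/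

open NearlyKaehler Filter Topology in
theorem theorem3p4
    {E₀ E₁ E₂ E : Type*}
    [NormedAddCommGroup E₀] [NormedSpace ℝ E₀] [FiniteDimensional ℝ E₀]
    [NormedAddCommGroup E₁] [NormedSpace ℝ E₁] [FiniteDimensional ℝ E₁]
    [NormedAddCommGroup E₂] [NormedSpace ℝ E₂] [FiniteDimensional ℝ E₂]
    [NormedAddCommGroup E] [NormedSpace ℝ E] [FiniteDimensional ℝ E]
    {MT Mperp Mθ N : Type*}
    -- the connected Riemannian manifold `MT`
    [TopologicalSpace MT] [ChartedSpace E₀ MT] [IsManifold 𝓘(ℝ, E₀) ∞ MT] [ConnectedSpace MT]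
    [RiemannianBundle (fun x : MT ↦ TangentSpace 𝓘(ℝ, E₀) x)]
    [IsContMDiffRiemannianBundle 𝓘(ℝ, E₀) ∞ E₀ (fun x : MT ↦ TangentSpace 𝓘(ℝ, E₀) x)]
    -- the Riemannian manifold `Mperp`
    [TopologicalSpace Mperp] [ChartedSpace E₁ Mperp] [IsManifold 𝓘(ℝ, E₁) ∞ Mperp]
    [Nonempty Mperp]
    [RiemannianBundle (fun x : Mperp ↦ TangentSpace 𝓘(ℝ, E₁) x)]
    [IsContMDiffRiemannianBundle 𝓘(ℝ, E₁) ∞ E₁ (fun x : Mperp ↦ TangentSpace 𝓘(ℝ, E₁) x)]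
    -- the Riemannian manifold `Mθ`, of positive dimension
    [TopologicalSpace Mθ] [ChartedSpace E₂ Mθ] [IsManifold 𝓘(ℝ, E₂) ∞ Mθ]
    [Nonempty Mθ] [Nontrivial E₂]
    [RiemannianBundle (fun x : Mθ ↦ TangentSpace 𝓘(ℝ, E₂) x)]
    [IsContMDiffRiemannianBundle 𝓘(ℝ, E₂) ∞ E₂ (fun x : Mθ ↦ TangentSpace 𝓘(ℝ, E₂) x)]
    -- the nearly Kaehler manifold `(N, J)`
    [TopologicalSpace N] [ChartedSpace E N] [IsManifold 𝓘(ℝ, E) ∞ N]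
    [RiemannianBundle (fun x : N ↦ TangentSpace 𝓘(ℝ, E) x)]
    [IsContMDiffRiemannianBundle 𝓘(ℝ, E) ∞ E (fun x : N ↦ TangentSpace 𝓘(ℝ, E) x)]
    (J : ∀ x : N, TangentSpace 𝓘(ℝ, E) x →L[ℝ] TangentSpace 𝓘(ℝ, E) x)
    (hJ : NearlyKaehler.IsNearlyKaehler J)
    -- the bi-warped product submanifold
    (f₁ f₂ : MT → ℝ) (θ : ℝ) (i : MT × Mperp × Mθ → N)
    (hi : NearlyKaehler.IsBiWarpedProductSubmanifold E₀ E₁ E₂ E J f₁ f₂ θ i)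
    (hmix : NearlyKaehler.IsMixedTotallyGeodesic E₀ E₁ E₂ E i) :
    ∃ c : ℝ, ∀ a : MT, f₂ a = c := by
  have : Nonempty MT := ConnectedSpace.toNonempty
  have hf₂ : MDifferentiable 𝓘(ℝ, E₀) 𝓘(ℝ, ℝ) f₂ := hi.smooth_f₂.mdifferentiable (by simp)
  refine exists_eq_const_of_mfderiv_eq_zero hf₂ fun a ↦ ?_
  -- Since `f₂` lives on `MT`, any point `p` of the product over `a` will do.
  obtain ⟨b⟩ := ‹Nonempty Mperp›
  obtain ⟨c⟩ := ‹Nonempty Mθ›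
  let I := tripleModel E₀ E₁ E₂
  let p : MT × Mperp × Mθ := (a, b, c)
  have hid : MDifferentiable I 𝓘(ℝ, E) i := hi.smooth.mdifferentiable (by simp)
  let q : N := i p
  let φ := extChartAt 𝓘(ℝ, E) q
  let ψ := extChartAt I p
  have hz : chartMap (E := E) I i p (ψ p) = φ q := chartMap_self i p
  have hq : φ.symm (φ q) = q := extChartAt_to_inv q
  -- near `p`, in the chart at `p`
  have hnear : ∀ᶠ z in 𝓝 (ψ p), z ∈ ψ.target ∧ i (ψ.symm z) ∈ (chartAt E q).source := by
    refine Filter.Eventually.and (extChartAt_target_mem_nhds (I := I) p)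
      (eventually_chart_symm (I := I) (p := p) (P := fun x ↦ i x ∈ (chartAt E q).source) ?_)
    exact (hid p).continuousAt.eventually
      ((chartAt E q).open_source.mem_nhds (mem_chart_source E q))
  have hF : ∀ z, i (ψ.symm z) ∈ (chartAt E q).source →
      φ.symm (chartMap (E := E) I i p z) = i (ψ.symm z) := fun z hz ↦
    φ.left_inv (by rwa [extChartAt_source])
  have hf₂a : DifferentiableAt ℝ (f₂ ∘ (extChartAt 𝓘(ℝ, E₀) a).symm)
      (extChartAt 𝓘(ℝ, E₀) a a) := by
    rw [← mdifferentiableAt_iff_differentiableAt]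
    exact (hf₂ _).comp _ (mdifferentiableAt_chart_symm (mem_extChartAt_target a))
  refine fderiv_warping_eq_zero (F := chartMap (E := E) I i p) (G := chartMetric q)
    (J := fun y ↦ chartEnd J q (φ.symm y)) (Γ := chartChristoffel q) (z := ψ p)
    (g₀ := chartMetric a) (g₁ := chartMetric b) (g₂ := chartMetric c)
    (f₁ := f₁ ∘ (extChartAt 𝓘(ℝ, E₀) a).symm) (contDiffAt_chartMap (hi.smooth p))
    ?_ ?_ hf₂a (hi.pos_f₂ _) ?_
    (fun v hv ↦ eq_zero_of_chartMetric_self_eq_zero (mem_extChartAt_target a) hv)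
    (fun v hv ↦ eq_zero_of_chartMetric_self_eq_zero (mem_extChartAt_target c) hv)
    (fun u v ↦ chartMetric_comm q _ u v) (chartChristoffel_comm q) ?_ ?_ ?_ ?_ ?_ ?_ ?_
  · rw [hz]
    exact differentiableAt_chartMetric q
  · rw [hz]
    exact hJ.differentiableAt_chartEnd q
  · rw [hz]
    exact fun v hv ↦ eq_zero_of_chartMetric_self_eq_zero (mem_extChartAt_target q) hv
  · rw [hz]
    exact fderiv_chartMetric q
  · simp only [hz, hq]
    exact hJ.chartEnd_sq q
  · rw [hz]
    filter_upwards [extChartAt_target_mem_nhds (I := 𝓘(ℝ, E)) q] with y hy v w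
    have hn : φ.symm y ∈ (chartAt E q).source := by
      rw [← extChartAt_source 𝓘(ℝ, E)]
      exact φ.map_target hy
    have h := hJ.chartMetric_chartEnd hn v w
    rwa [φ.right_inv hy] at h
  · simp only [hz, hq]
    exact hJ.fderiv_chartEnd q
  · filter_upwards [hnear] with z ⟨hzt, hzs⟩ u v
    have hzt' := hzt
    simp only [ψ, I, extChartAt_prod, PartialEquiv.prod_target] at hzt'
    have hzs' := hzs
    rw [← extChartAt_source 𝓘(ℝ, E)] at hzs'
    rw [fderiv_chartMap hid hzt hzs, fderiv_chartMap hid hzt hzs]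
    refine (chartMetric_chart hzs' _ _).trans ?_
    rw [constField_mfderiv_chart hzs, constField_mfderiv_chart hzs, hi.isometric, biWarpedMetric,
      dπ₀_mfderiv_chart_symm hzt, dπ₀_mfderiv_chart_symm hzt, dπ₁_mfderiv_chart_symm hzt,
      dπ₁_mfderiv_chart_symm hzt, dπ₂_mfderiv_chart_symm hzt, dπ₂_mfderiv_chart_symm hzt]
    rfl
  · filter_upwards [hnear] with z ⟨hzt, hzs⟩ u
    have hu := (mfderiv_chart_symm_mem_dist₀_iff hzt (u, 0, 0)).mpr rfl
    have h1 := hi.holomorphic (ψ.symm z)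
    have h2 : J _ (mfderiv I 𝓘(ℝ, E) i (ψ.symm z)
        (mfderiv 𝓘(ℝ, E₀ × E₁ × E₂) I ψ.symm z (u, 0, 0))) ∈
        pushSubspace E i (ψ.symm z) (dist₀ E₀ E₁ E₂ (ψ.symm z)) := by
      rw [← h1]
      exact Submodule.mem_map_of_mem (Submodule.mem_map_of_mem hu)
    obtain ⟨v, hv, hvJ⟩ := h2
    -- Every tangent vector has coordinates `a'` in the chart at `p`; lying in the first
    -- distribution kills the last two.
    obtain ⟨a', rfl⟩ := surjective_mfderiv_chart_symm hzt v
    have ha' := (mfderiv_chart_symm_mem_dist₀_iff hzt a').mp hv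
    obtain ⟨u', r⟩ := a'
    obtain rfl : r = 0 := ha'
    refine ⟨u', ?_⟩
    rw [hF z hzs, fderiv_chartMap hid hzt hzs]
    refine (chartEnd_mfderiv_chart hzs _).trans ?_
    rw [← hvJ]
    exact (fderiv_chartMap hid hzt hzs (u', 0, 0)).symm
  · intro u w
    refine exists_of_secondFundamentalForm_eq_zero hi.smooth ?_
    -- Constant-component fields are admissible: smooth around `p` and in the required distribution
    -- at every point.
    exact hmix p _ _ (contMDiffAt_constField (mem_chart_source _ p) _)
      (contMDiffAt_constField (mem_chart_source _ p) _)
      (constField_mem fun z hz ↦ (mfderiv_chart_symm_mem_dist₀_iff hz _).mpr rfl)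
      (constField_mem fun z hz ↦ mfderiv_chart_symm_mem_dist₂ hz w)
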